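/- All graphs are finite and simple; $\overline{G}$ is the complement of $G$, and $K_d$ is the complete graph on $d$ vertices. $G^{\boxtimes k}$ is the $k$-fold strong product: its vertices are the $k$-tuples of vertices of $G$, and two distinct tuples are adjacent iff in every coordinate they are equal or adjacent in $G$. Write $G\overset{qc}{\to}H$ if there are a unital $C^*$-algebra $\mathcal{A}$ with a tracial state and projections $E_{g,h}\in\mathcal{A}$ ($g\in V(G)$, $h\in V(H)$) such that $\sum_{h}E_{g,h}=I$ for every $g$, and $E_{g,h}E_{g',h'}=0$ whenever $\{g,g'\}\in E(G)$ and either $\{h,h'\}\in E(\overline{H})$ or $h=h'$. The commuting quantum independence number and the commuting quantum Shannon capacity are $$\alpha_{qc}(G)=\max\{d\in\mathbb{N}: K_d\overset{qc}{\to}\overline{G}\},\qquad \Theta_{qc}(G)=\lim_{k\to\infty}\sqrt[k]{\alpha_{qc}(G^{\boxtimes k})}.$$ For $\lambda>0$, a $\lambda$-tracial subspace representation of $G$ consists of a von Neumann algebra $\mathcal{M}$ on a Hilbert space, a normal tracial state $\tau$ on $\mathcal{M}$, and projections $E_g\in\mathcal{M}$ ($g\in V(G)$) such that, for every $g\in V(G)$,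 $\tau(E_g)=1/\lambda$ and $E_g\wedge\bigvee_{g':\{g,g'\}\in E(\overline{G})}E_{g'}=0$. The tracial Haemers bound is $$\mathcal{H}_{tr}(G)=\inf\{\lambda>0: G\text{ has a }\lambda\text{-tracial subspace representation}\}.$$ Then for every graph $G$ the maximum defining $\alpha_{qc}(G)$ and the limit defining $\Theta_{qc}(G)$ exist, and $$\alpha_{qc}(G)\le\mathcal{H}_{tr}(G),\qquad\text{and moreover}\qquad \alpha_{qc}(G)\le\Theta_{qc}(G)\le\mathcal{H}_{tr}(G).$$ -/

import Mathlib

open Filter Topology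

universe u v w x

noncomputable section

/-- A tracial state on a unital complex `*`-algebra: a linear functional that is positive
(`τ (x* x)` is real and nonnegative), unital, and satisfies `τ (x y) = τ (y x)`. -/
structure IsTracialState {A : Type u} [Ring A] [StarRing A] [Algebra ℂ A]
    (τ : A →ₗ[ℂ] ℂ) : Prop where
  nonneg : ∀ a : A, 0 ≤ (τ (star a * a)).re ∧ (τ (star a * a)).im = 0
  map_one : τ 1 = 1
  trace_comm : ∀ a b : A, τ (a * b) = τ (b * a)

/-! ### Commuting quantum homomorphisms, independence number and Shannon capacity -/

/-- There is a commuting quantum homomorphism from `G` to `H`: a unital C*-algebra `A` with a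
tracial state, and projections `E g h` in `A` that sum to `1` over `h` and satisfy
`E g h * E g' h' = 0` whenever `g, g'` are adjacent in `G` and `h, h'` are equal or adjacent
in the complement of `H`. -/
def QCHom {V : Type w} {W : Type x} [Fintype W] (G : SimpleGraph V) (H : SimpleGraph W) : Prop :=
  ∃ (A : Type u) (_ : CStarAlgebra A) (τ : A →ₗ[ℂ] ℂ) (E : V → W → A),
    IsTracialState τ ∧
    (∀ g h, IsStarProjection (E g h)) ∧
    (∀ g, ∑ h, E g h = 1) ∧
    ∀ g g' h h', G.Adj g g' → (Hᶜ.Adj h h' ∨ h = h') → E g h * E g' h' = 0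

/-- The numbers `d` such that there is a commuting quantum homomorphism from the complete graph
`K_d` to the complement of `G`. -/
def qcIndepSet {V : Type w} [Fintype V] (G : SimpleGraph V) : Set ℕ :=
  {d | QCHom.{u} (⊤ : SimpleGraph (Fin d)) Gᶜ}

/-- The commuting quantum independence number: the largest element of `qcIndepSet G`. -/
def alphaQC {V : Type w} [Fintype V] (G : SimpleGraph V) : ℕ :=
  sSup (qcIndepSet.{u} G)

/-- The `k`-fold strong product of `G` with itself, on the vertex set `V ^ k`: distinct tuples
are adjacent when they are equal or adjacent in every coordinate. -/
def strongPow {V : Type w} (G : SimpleGraph V) (k : ℕ) : SimpleGraph (Fin k → V) where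
  Adj a b := a ≠ b ∧ ∀ i, a i = b i ∨ G.Adj (a i) (b i)
  symm := ⟨fun _ _ h => ⟨h.1.symm, fun i => (h.2 i).imp Eq.symm SimpleGraph.Adj.symm⟩⟩
  loopless := ⟨fun _ h => h.1 rfl⟩

/-- The `k`-th term `α_qc (G ^ k) ^ (1 / k)` of the sequence defining the capacity. -/
def thetaQCSeq {V : Type w} [Fintype V] (G : SimpleGraph V) (k : ℕ) : ℝ :=
  (alphaQC.{u} (strongPow G k) : ℝ) ^ (1 / (k : ℝ))

/-- The commuting quantum Shannon capacity. -/
def thetaQC {V : Type w} [Fintype V] (G : SimpleGraph V) : ℝ :=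
  limUnder atTop (thetaQCSeq.{u} G)

/-! ### The tracial Haemers bound -/

section Hilbert

variable {H : Type v} [NormedAddCommGroup H] [InnerProductSpace ℂ H] [CompleteSpace H]

/-- `P ∧ Q`: the projection onto the intersection of the ranges of the projections `P` and `Q`
(this intersection is closed; the closure makes the definition total). -/
def projMeet (P Q : H →L[ℂ] H) : H →L[ℂ] H :=
  (P.range ⊓ Q.range).topologicalClosure.starProjection

/-- `⋁ i ∈ s, P i`: the projection onto the closed linear span of the ranges of the `P i`. -/
def projJoin {ι : Type w} (s : Set ι) (P : ι → H →L[ℂ] H) : H →L[ℂ] H :=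
  (⨆ i ∈ s, (P i).range).topologicalClosure.starProjection

/-- A functional on a von Neumann algebra is normal if `τ (X i) → τ Y` for every increasing net
`X` of positive elements of the algebra that converges strongly to an element `Y` of it. -/
def IsNormalFunctional (M : VonNeumannAlgebra H) (τ : M.toStarSubalgebra →ₗ[ℂ] ℂ) : Prop :=
  ∀ (ι : Type v) [Preorder ι] [IsDirectedOrder ι] [Nonempty ι]
    (X : ι → M.toStarSubalgebra) (Y : M.toStarSubalgebra),
    (∀ i, 0 ≤ (X i : H →L[ℂ] H)) →
    (∀ i j, i ≤ j → (X i : H →L[ℂ] H) ≤ (X j : H →L[ℂ] H)) →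
    (∀ η : H, Tendsto (fun i => (X i : H →L[ℂ] H) η) atTop (𝓝 ((Y : H →L[ℂ] H) η))) →
    Tendsto (fun i => τ (X i)) atTop (𝓝 (τ Y))

end Hilbert

/-- `G` has a `lam`-tracial subspace representation: a von Neumann algebra `M` on a Hilbert space
with a normal tracial state `τ`, and projections `E g` in `M` of trace `1 / lam` such that the
meet of `E g` with the join of all `E g'`, for `g'` adjacent to `g` in the complement of `G`,
is zero. -/
def HasTracialSubspaceRep {V : Type w} (G : SimpleGraph V) (lam : ℝ) : Prop :=
  ∃ (H : Type v) (_ : NormedAddCommGroup H) (_ : InnerProductSpace ℂ H) (_ : CompleteSpace H)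
    (M : VonNeumannAlgebra H) (τ : M.toStarSubalgebra →ₗ[ℂ] ℂ) (E : V → M.toStarSubalgebra),
    IsTracialState τ ∧
    IsNormalFunctional M τ ∧
    (∀ g, IsStarProjection (E g)) ∧
    (∀ g, projMeet (E g : H →L[ℂ] H)
      (projJoin (Gᶜ.neighborSet g) (fun g' => (E g' : H →L[ℂ] H))) = 0) ∧
    ∀ g, τ (E g) = ((1 / lam : ℝ) : ℂ)

/-- The tracial Haemers bound: the infimum of all `lam > 0` for which `G` has a `lam`-tracial
subspace representation. -/
def tracialHaemers {V : Type w} (G : SimpleGraph V) : ℝ :=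
  sInf {lam : ℝ | 0 < lam ∧ HasTracialSubspaceRep.{v} G lam}

end

/-!
Everything is reduced to statements about tracial states on `*`-algebras, where tensor products are
purely algebraic; a completion is needed only to return from such an algebra to a C*-algebra.

*Representations.* For projections in a von Neumann algebra with a normal trace, `P ∧ ⋁ S = 0`
implies `ApproxSeparated`: there are elements `Z` of the algebra with `Z Q = 0` for `Q ∈ S` and
`Z P` arbitrarily close to `P` in trace norm. Indeed, with `B = ⋁ S`, the positive contraction
`T = P B P` fixes no nonzero vector, so its powers tend strongly to `0`, and, for `n > 0`,
`Z = (∑ k < n, T ^ k) P (1 - B)` satisfies `Z P = P - T ^ n`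
(`HasTracialSubspaceRep.hasAlgRep`). Approximate separation passes to tensor products
(`ApproxSeparated.tmul`), so a representation of `G` with parameter `lam` yields one of the `k`-fold
strong product with parameter `lam ^ k` (`HasAlgRep.strongPow`).

*Upper bound.* If `E i g` are the projections of a commuting quantum homomorphism from `K_d` to the
complement of `G`, and `F g` those of a representation of `G`, the projections
`∑ g, E i g ⊗ F g`, for `i < d`, have trace `1 / lam` and are approximately separated from each
other. The analytic core, `IsTracialState.sum_trace_le_one`, says that such projections have total
trace at most `1`; it replaces the formula `τ (P ∨ Q) = τ P + τ Q` for `P ∧ Q = 0` in a finite von Neumann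
algebra by a Cauchy–Schwarz argument with polynomials in `∑ i, P i`. Hence `d ≤ lam`
(`HasAlgRep.le_of_qcHom`), and applied to strong powers `α_qc (G ^ k) ≤ lam ^ k`.

*Existence of the maximum and of the limit.* Every graph with a vertex has a representation with
parameter the number of vertices, which bounds `α_qc`. Tensoring the projections of two quantum
homomorphisms gives `α_qc (G ^ k) α_qc (G ^ l) ≤ α_qc (G ^ (k + l))`; the tensor product is made
into a C*-algebra by the Gelfand–Naimark–Segal construction for its trace
(`QCHom.of_tracialAlgebra`).
Fekete's lemma then shows that the `k`-th roots converge to their supremum.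
-/

noncomputable section

open scoped TensorProduct

/-! ### Tracial states on `*`-algebras -/

/-- The squared trace norm `‖a‖₂² = τ (a* a)` attached to a tracial state. -/
def trSq {A : Type*} [Ring A] [StarRing A] [Algebra ℂ A] (τ : A →ₗ[ℂ] ℂ) (a : A) : ℝ :=
  (τ (star a * a)).re

/-- The functional `x ↦ τ (x* b x)` is nonnegative: `b` acts as a positive form on the
pre-Hilbert space of `τ`. -/
def IsTracePos {A : Type*} [Ring A] [StarRing A] [Algebra ℂ A] (τ : A →ₗ[ℂ] ℂ) (b : A) : Prop :=
  ∀ x : A, 0 ≤ (τ (star x * b * x)).re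

/-- `P` is approximately separated from the elements of `S`: up to an arbitrarily small error
in trace norm, some element of the algebra fixes `P` from the left and annihilates `S`. For
projections in a von Neumann algebra with normal trace this is what remains of the condition
`P ∧ ⋁ S = 0`, and it makes sense in every tracial `*`-algebra. -/
def ApproxSeparated {A : Type*} [Ring A] [StarRing A] [Algebra ℂ A] (τ : A →ₗ[ℂ] ℂ)
    (P : A) (S : Set A) : Prop :=
  ∀ ε : ℝ, 0 < ε → ∃ Z : A, (∀ Q ∈ S, Z * Q = 0) ∧ trSq τ (Z * P - P) < ε

section Trace

variable {A : Type*} [Ring A] [StarRing A] [Algebra ℂ A] {τ : A →ₗ[ℂ] ℂ}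

theorem IsTracialState.trSq_nonneg (hτ : IsTracialState τ) (a : A) : 0 ≤ trSq τ a :=
  (hτ.nonneg a).1

theorem IsTracialState.map_star_mul_self (hτ : IsTracialState τ) (a : A) :
    τ (star a * a) = (trSq τ a : ℂ) := by
  apply Complex.ext <;> simp [trSq, (hτ.nonneg a).2]

theorem IsTracialState.isTracePos_one (hτ : IsTracialState τ) : IsTracePos τ 1 := fun x => by
  simpa using (hτ.nonneg x).1

theorem IsTracialState.isTracePos_projection (hτ : IsTracialState τ) {p : A}
    (hp : IsStarProjection p) : IsTracePos τ p := fun x => by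
  have h := (hτ.nonneg (p * x)).1
  rwa [star_mul, hp.isSelfAdjoint.star_eq, mul_assoc, ← mul_assoc p p x,
    hp.isIdempotentElem.eq, ← mul_assoc] at h

theorem IsTracePos.add {a b : A} (ha : IsTracePos τ a) (hb : IsTracePos τ b) :
    IsTracePos τ (a + b) := fun x => by
  rw [mul_add, add_mul, map_add, Complex.add_re]
  exact add_nonneg (ha x) (hb x)

theorem IsTracePos.sum {ι : Type*} {s : Finset ι} {b : ι → A} (h : ∀ i ∈ s, IsTracePos τ (b i)) :
    IsTracePos τ (∑ i ∈ s, b i) := fun x => by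
  rw [Finset.mul_sum, Finset.sum_mul, map_sum, Complex.re_sum]
  exact Finset.sum_nonneg fun i hi => h i hi x

theorem IsTracePos.smul {b : A} (hb : IsTracePos τ b) {r : ℝ} (hr : 0 ≤ r) :
    IsTracePos τ ((r : ℂ) • b) := fun x => by
  rw [mul_smul_comm, smul_mul_assoc, map_smul, smul_eq_mul, Complex.re_ofReal_mul]
  exact mul_nonneg hr (hb x)

theorem IsTracePos.conj {b c : A} (hb : IsTracePos τ b) (hc : IsSelfAdjoint c) :
    IsTracePos τ (c * b * c) := fun x => by
  have h := hb (c * x)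
  rwa [star_mul, hc.star_eq, show star x * c * b * (c * x) = star x * (c * b * c) * x by
    noncomm_ring] at h

theorem IsTracePos.pow (hτ : IsTracialState τ) {K : A} (hK : IsTracePos τ K)
    (hs : IsSelfAdjoint K) (n : ℕ) : IsTracePos τ (K ^ n) := by
  obtain ⟨m, rfl | rfl⟩ := Nat.even_or_odd' n
  · have := hτ.isTracePos_one.conj (hs.pow m)
    rwa [mul_one, ← pow_add, ← two_mul] at this
  · have := hK.conj (hs.pow m)
    rwa [← pow_succ, ← pow_add, show m + 1 + m = 2 * m + 1 by ring] at this

/-- If `K` and `1 - K` are positive forms, so is `(1 - K) K ^ n`. For odd `n` this uses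
`(1 - K) K = K (1 - K) K + (1 - K) K (1 - K)`. -/
theorem IsTracePos.one_sub_mul_pow {K : A} (hK : IsTracePos τ K) (hs : IsSelfAdjoint K)
    (hL : IsTracePos τ (1 - K)) (n : ℕ) : IsTracePos τ ((1 - K) * K ^ n) := by
  have hc (m : ℕ) : K ^ m * K = K * K ^ m := (pow_succ K m).symm.trans (pow_succ' K m)
  obtain ⟨m, rfl | rfl⟩ := Nat.even_or_odd' n
  · have h := hL.conj (hs.pow m)
    rwa [mul_sub, sub_mul, mul_one, hc, mul_assoc, ← pow_add, ← two_mul,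
      ← one_sub_mul] at h
  · have h1 : IsTracePos τ ((1 - K) * K) := by
      have h := (hL.conj hs).add (hK.conj ((IsSelfAdjoint.one A).sub hs))
      rwa [show K * (1 - K) * K + (1 - K) * K * (1 - K) = (1 - K) * K by noncomm_ring] at h
    have h := h1.conj (hs.pow m)
    have e : K ^ m * ((1 - K) * K) * K ^ m = (1 - K) * K ^ (2 * m + 1) := by
      have hcm : Commute (K ^ m) (1 - K) :=
        (Commute.one_right _).sub_right ((Commute.refl K).pow_left m)
      rw [← mul_assoc, hcm.eq, mul_assoc, mul_assoc, ← pow_succ', ← pow_add]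
      congr 2; ring
    rwa [e] at h

theorem IsTracialState.trSq_star (hτ : IsTracialState τ) (a : A) : trSq τ (star a) = trSq τ a := by
  rw [trSq, trSq, hτ.trace_comm, star_star]

theorem IsTracialState.trSq_add_le (hτ : IsTracialState τ) (a b : A) :
    trSq τ (a + b) ≤ 2 * trSq τ a + 2 * trSq τ b := by
  have h := hτ.trSq_nonneg (a - b)
  have h' : trSq τ (a + b) + trSq τ (a - b) = 2 * trSq τ a + 2 * trSq τ b := by
    simp only [trSq, star_sub, star_add, sub_mul, mul_sub, add_mul, mul_add, map_sub, map_add,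
      Complex.sub_re, Complex.add_re]
    ring
  linarith

variable [StarModule ℂ A]

/-- A tracial state is hermitian: this follows from `τ (a* a) ∈ ℝ` by polarization. -/
theorem IsTracialState.map_star (hτ : IsTracialState τ) (a : A) :
    τ (star a) = star (τ a) := by
  have h0 := (hτ.nonneg a).2
  have h1 := (hτ.nonneg (1 + a)).2
  have h2 := (hτ.nonneg (1 + Complex.I • a)).2
  have h3 : (τ (1 : A)).im = 0 := by rw [hτ.map_one]; simp
  simp only [star_add, star_one, add_mul, mul_add, one_mul, mul_one, map_add, Complex.add_im,
    star_smul, smul_mul_assoc, mul_smul_comm, map_smul, smul_eq_mul, h0, h3] at h1 h2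
  simp only [RCLike.star_def, Complex.conj_I, neg_mul, Complex.neg_im, Complex.I_mul_re,
    Complex.mul_im, Complex.neg_re, h0] at h2
  simp at h2
  apply Complex.ext
  · simp; linarith
  · simp; linarith

theorem IsTracialState.map_star_re (hτ : IsTracialState τ) (a : A) :
    (τ (star a)).re = (τ a).re := by
  rw [hτ.map_star]; simp

theorem IsTracialState.trSq_sub (hτ : IsTracialState τ) (a b : A) :
    trSq τ (a - b) = trSq τ a - 2 * (τ (star b * a)).re + trSq τ b := by
  have h : (τ (star a * b)).re = (τ (star b * a)).re := by
    rw [← hτ.map_star_re, star_mul, star_star]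
  simp only [trSq, star_sub, sub_mul, mul_sub, map_sub, Complex.sub_re, h]
  ring

/-- The semi-inner product `⟪a, b⟫ = τ (a* b)`. -/
abbrev IsTracialState.core (hτ : IsTracialState τ) : PreInnerProductSpace.Core ℂ A where
  inner a b := τ (star a * b)
  conj_inner_symm a b := by
    rw [← Complex.star_def, ← hτ.map_star, star_mul, star_star]
  re_inner_nonneg a := (hτ.nonneg a).1
  add_left a b c := by rw [star_add, add_mul, map_add]
  smul_left a b r := by
    rw [star_smul, smul_mul_assoc, map_smul, smul_eq_mul, Complex.star_def]

theorem IsTracialState.cauchy_schwarz (hτ : IsTracialState τ) (a b : A) :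
    (τ (star a * b)).re ^ 2 ≤ trSq τ a * trSq τ b := by
  have h : ‖τ (star a * b)‖ * ‖τ (star b * a)‖ ≤ trSq τ a * trSq τ b :=
    @InnerProductSpace.Core.inner_mul_inner_self_le ℂ A _ _ _ hτ.core a b
  rw [← norm_star (τ (star b * a)), ← hτ.map_star, star_mul, star_star] at h
  calc (τ (star a * b)).re ^ 2 = |(τ (star a * b)).re| * |(τ (star a * b)).re| := by
        rw [abs_mul_abs_self, sq]
    _ ≤ ‖τ (star a * b)‖ * ‖τ (star a * b)‖ := by
        gcongr <;> exact Complex.abs_re_le_norm _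
    _ ≤ _ := h

/-! ### Approximately separated projections have total trace at most one -/

/-- The lower bound for `τ (P B P)`, with `B = ∑ k < n, K ^ k`, that comes from
`0 ≤ τ ((P - d L Z*)* B (P - d L Z*))` and `L B = 1 - K ^ n`, where `L = 1 - K`. -/
theorem IsTracialState.le_trace_geom_sum (hτ : IsTracialState τ) {K P Z : A} {d : ℝ} (hd : 0 < d)
    (hK : IsTracePos τ K) (hs : IsSelfAdjoint K) (hL : IsTracePos τ (1 - K))
    (hP : IsStarProjection P) (hZ : (d : ℂ) • (Z * (1 - K)) = Z * P) (n : ℕ) :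
    d * ((τ P).re - trSq τ (Z * P - P) - 2 * (τ (P * K ^ n * star Z)).re) ≤
      (τ (P * (∑ k ∈ Finset.range n, K ^ k) * P)).re := by
  set B := ∑ k ∈ Finset.range n, K ^ k with hB
  have hP1 := hP.isSelfAdjoint.star_eq
  have hP2 := hP.isIdempotentElem.eq
  have hBpos : IsTracePos τ B := IsTracePos.sum fun k _ => hK.pow hτ hs k
  have hBs : star B = B := by
    rw [hB, star_sum]; exact Finset.sum_congr rfl fun k _ => (hs.pow k).star_eq
  have hLB : (1 - K) * B = 1 - K ^ n := mul_neg_geom_sum K n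
  have hBL : B * (1 - K) = 1 - K ^ n := geom_sum_mul_neg K n
  have hZ' : (d : ℂ) • ((1 - K) * star Z) = P * star Z := by
    have := congrArg star hZ
    rwa [star_smul, star_mul, star_mul, star_sub, star_one, hs.star_eq, hP1, Complex.star_def,
      Complex.conj_ofReal] at this
  have h := hBpos (P - P * star Z)
  have e1 : star (P - P * star Z) * B * (P - P * star Z) =
      P * B * P - P * B * (P * star Z) - star (P * B * (P * star Z)) +
        Z * P * B * (P * star Z) := by
    simp only [star_sub, star_mul, star_star, hP1, hBs]
    noncomm_ring
  have e2 : P * B * (P * star Z) = (d : ℂ) • (P * star Z - P * K ^ n * star Z) :=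
    calc P * B * (P * star Z) = P * B * ((d : ℂ) • ((1 - K) * star Z)) := by rw [hZ']
      _ = (d : ℂ) • (P * (B * (1 - K)) * star Z) := by rw [mul_smul_comm]; congr 1; noncomm_ring
      _ = _ := by rw [hBL, mul_sub, sub_mul, mul_one]
  have e3 : Z * P * B * (P * star Z) =
      (d : ℂ) • (Z * P * star Z) - ((d * d : ℝ) : ℂ) • (Z * ((1 - K) * K ^ n) * star Z) :=
    have hc : K ^ n * K = K * K ^ n := (pow_succ K n).symm.trans (pow_succ' K n)
    calc Z * P * B * (P * star Z)
        = ((d : ℂ) • (Z * (1 - K))) * B * ((d : ℂ) • ((1 - K) * star Z)) := by rw [hZ', hZ]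
      _ = ((d * d : ℝ) : ℂ) • (Z * ((1 - K) * B) * (1 - K) * star Z) := by
        rw [mul_smul_comm, smul_mul_assoc, smul_mul_assoc, smul_smul, Complex.ofReal_mul]
        congr 1; simp only [mul_assoc]
      _ = ((d * d : ℝ) : ℂ) • (Z * (1 - K) * star Z - Z * ((1 - K) * K ^ n) * star Z) := by
        rw [hLB, mul_assoc Z, show (1 - K ^ n) * (1 - K) = (1 - K) - (1 - K) * K ^ n by
          rw [mul_sub, mul_one, sub_mul, sub_mul, hc, one_mul, one_mul]; abel, mul_sub, sub_mul]
      _ = _ := by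
        rw [smul_sub, ← hZ, smul_mul_assoc, smul_smul, Complex.ofReal_mul]
  have hpos := (hK.one_sub_mul_pow hs hL n) (star Z)
  rw [star_star] at hpos
  have hq : trSq τ (Z * P - P) = (τ (Z * P * star Z)).re - 2 * (τ (P * star Z)).re + (τ P).re := by
    rw [hτ.trSq_sub]
    congr 1
    · congr 1
      · rw [trSq, hτ.trace_comm, star_mul, hP1, ← mul_assoc, mul_assoc Z P P, hP2]
      · rw [← hτ.map_star_re (P * star Z), star_mul, star_star, hP1, hτ.trace_comm, mul_assoc, hP2]
    · rw [trSq, hP1, hP2]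
  rw [e1, map_add, map_sub, map_sub, Complex.add_re, Complex.sub_re, Complex.sub_re,
    hτ.map_star_re, e2, e3] at h
  simp only [map_smul, map_sub, smul_eq_mul, Complex.re_ofReal_mul, Complex.sub_re] at h
  rw [hq]
  nlinarith [mul_nonneg (mul_nonneg hd.le hd.le) hpos]

/-- If every projection of a finite family is approximately separated from all the others, the
traces sum to at most `1`. With `L = d⁻¹ ∑ P i` and `K = 1 - L`, the average of the `1 - P i`, one
has `∑ τ (P i B P i) = d (1 - τ (K ^ n)) ≤ d`, while `le_trace_geom_sum` bounds every summand from
below by nearly `d τ (P i)`; the error `τ (P i K ^ n Z*)` vanishes in the limit because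
`τ (L K ^ k)` is summable over `k`. -/
theorem IsTracialState.sum_trace_le_one (hτ : IsTracialState τ) {ι : Type*} [Fintype ι]
    {P : ι → A} (hP : ∀ i, IsStarProjection (P i))
    (hsep : ∀ i, ApproxSeparated τ (P i) {Q | ∃ j, j ≠ i ∧ Q = P j}) :
    ∑ i, (τ (P i)).re ≤ 1 := by
  rcases isEmpty_or_nonempty ι with hι | hι
  · simp
  set d : ℝ := (Fintype.card ι : ℝ) with hd_def
  have hd : 0 < d := by rw [hd_def]; exact_mod_cast Fintype.card_pos
  set L : A := ((d⁻¹ : ℝ) : ℂ) • ∑ i, P i with hL_def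
  obtain ⟨K, hKL⟩ : ∃ K : A, K = 1 - L := ⟨_, rfl⟩
  have hLK : 1 - K = L := by rw [hKL, sub_sub_cancel]
  have hdL : (d : ℂ) • L = ∑ i, P i := by
    rw [hL_def, smul_smul, ← Complex.ofReal_mul, mul_inv_cancel₀ hd.ne', Complex.ofReal_one,
      one_smul]
  have hKavg : K = ((d⁻¹ : ℝ) : ℂ) • ∑ i, (1 - P i) := by
    have h1 : (d : ℂ) • (1 : A) = ∑ _i : ι, (1 : A) := by
      rw [Finset.sum_const, Finset.card_univ, hd_def, Complex.ofReal_natCast,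
        Nat.cast_smul_eq_nsmul]
    rw [Finset.sum_sub_distrib, smul_sub, ← hL_def, ← h1, smul_smul, ← Complex.ofReal_mul,
      inv_mul_cancel₀ hd.ne', Complex.ofReal_one, one_smul, hKL]
  have hLpos : IsTracePos τ (1 - K) := by
    rw [hLK]
    exact (IsTracePos.sum fun i _ => hτ.isTracePos_projection (hP i)).smul (inv_nonneg.2 hd.le)
  have hKpos : IsTracePos τ K := by
    rw [hKavg]
    exact (IsTracePos.sum fun i _ => hτ.isTracePos_projection (hP i).one_sub).smul
      (inv_nonneg.2 hd.le)
  have hLs : IsSelfAdjoint L := by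
    rw [IsSelfAdjoint, hL_def, star_smul, star_sum, Complex.star_def, Complex.conj_ofReal]
    simp only [(hP _).isSelfAdjoint.star_eq]
  have hKs : IsSelfAdjoint K := by rw [hKL]; exact (IsSelfAdjoint.one A).sub hLs
  have hone : (τ 1).re = 1 := by rw [hτ.map_one]; simp
  -- `τ (L K ^ k)` is nonnegative, and its partial sums telescope to `1 - τ (K ^ n) ≤ 1`.
  have ha0 (k : ℕ) : 0 ≤ (τ (L * K ^ k)).re := by
    have := hKpos.one_sub_mul_pow hKs hLpos k 1
    rwa [star_one, one_mul, mul_one, hLK] at this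
  have hsum (n : ℕ) : (τ (L * ∑ k ∈ Finset.range n, K ^ k)).re ≤ 1 := by
    have h := hKpos.pow hτ hKs n 1
    rw [star_one, one_mul, mul_one] at h
    rw [← hLK, mul_neg_geom_sum, map_sub, Complex.sub_re, hone]
    linarith
  have hsummable : Summable fun k => (τ (L * K ^ k)).re :=
    summable_of_sum_range_le ha0 fun n => by
      simpa only [Finset.mul_sum, map_sum, Complex.re_sum] using hsum n
  have hlim0 : Tendsto (fun n : ℕ => (τ (L * K ^ (2 * n))).re) atTop (𝓝 0) :=
    hsummable.tendsto_atTop_zero.comp (tendsto_id.const_mul_atTop' (by norm_num))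
  have hlim (i : ι) (Z : A) : Tendsto (fun n : ℕ => (τ (P i * K ^ n * star Z)).re) atTop (𝓝 0) := by
    have hi := (hP i).isSelfAdjoint.star_eq
    have hb (n : ℕ) : (τ (P i * K ^ n * star Z)).re ^ 2 ≤
        d * (τ (L * K ^ (2 * n))).re * trSq τ (star Z) := by
      have h1 := hτ.cauchy_schwarz (K ^ n * P i) (star Z)
      rw [star_mul, hi, (hKs.pow n).star_eq] at h1
      refine h1.trans (mul_le_mul_of_nonneg_right ?_ (hτ.trSq_nonneg _))
      have e1 (j : ι) : (τ (P j * K ^ (2 * n))).re = trSq τ (P j * K ^ n) := by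
        rw [trSq, star_mul, (hP j).isSelfAdjoint.star_eq, (hKs.pow n).star_eq, mul_assoc,
          ← mul_assoc (P j), (hP j).isIdempotentElem.eq, hτ.trace_comm (K ^ n), mul_assoc,
          ← pow_add, two_mul]
      have e2 : d * (τ (L * K ^ (2 * n))).re = ∑ j, (τ (P j * K ^ (2 * n))).re := by
        rw [← Complex.re_ofReal_mul, ← smul_eq_mul, ← map_smul, ← smul_mul_assoc, hdL,
          Finset.sum_mul, map_sum, Complex.re_sum]
      rw [e2, ← hτ.trSq_star (K ^ n * P i), star_mul, hi, (hKs.pow n).star_eq, ← e1]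
      exact Finset.single_le_sum (f := fun j => (τ (P j * K ^ (2 * n))).re)
        (fun j _ => by rw [e1]; exact hτ.trSq_nonneg _) (Finset.mem_univ i)
    have h2 : Tendsto (fun n : ℕ => (τ (P i * K ^ n * star Z)).re ^ 2) atTop (𝓝 0) :=
      squeeze_zero (fun n => sq_nonneg _) hb (by simpa using (hlim0.const_mul d).mul_const _)
    have h3 := h2.sqrt
    simp only [Real.sqrt_sq_eq_abs, Real.sqrt_zero] at h3
    exact (tendsto_zero_iff_abs_tendsto_zero _).2 h3
  -- Up to a total error `δ` in the choice of the `Z i`, the bound holds.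
  refine le_of_forall_pos_le_add fun δ hδ => ?_
  choose Z hZ0 hZε using fun i => hsep i (δ / d) (div_pos hδ hd)
  have hZL (i : ι) : (d : ℂ) • (Z i * (1 - K)) = Z i * P i := by
    rw [hLK, ← mul_smul_comm, hdL, Finset.mul_sum]
    exact Finset.sum_eq_single i (fun j _ hj => hZ0 i _ ⟨j, hj, rfl⟩) (by simp)
  have hle (n : ℕ) : ∑ i, (τ (P i)).re ≤
      1 + δ + 2 * ∑ i, (τ (P i * K ^ n * star (Z i))).re := by
    have h1 := Finset.sum_le_sum fun i (_ : i ∈ Finset.univ) =>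
      hτ.le_trace_geom_sum hd hKpos hKs hLpos (hP i) (hZL i) n
    have h2 : ∑ i, (τ (P i * (∑ k ∈ Finset.range n, K ^ k) * P i)).re =
        d * (τ (L * ∑ k ∈ Finset.range n, K ^ k)).re := by
      rw [← Complex.re_ofReal_mul, ← smul_eq_mul, ← map_smul, ← smul_mul_assoc, hdL,
        Finset.sum_mul, map_sum, Complex.re_sum]
      refine Finset.sum_congr rfl fun i _ => ?_
      rw [hτ.trace_comm, ← mul_assoc, (hP i).isIdempotentElem.eq]
    have h3 : ∑ i, trSq τ (Z i * P i - P i) ≤ δ := by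
      calc ∑ i, trSq τ (Z i * P i - P i) ≤ ∑ _i : ι, δ / d :=
            Finset.sum_le_sum fun i _ => (hZε i).le
        _ = δ := by
          rw [Finset.sum_const, Finset.card_univ, nsmul_eq_mul, ← hd_def]; field_simp
    rw [h2, ← Finset.mul_sum] at h1
    have h4 := le_of_mul_le_mul_left h1 hd
    rw [Finset.sum_sub_distrib, Finset.sum_sub_distrib, ← Finset.mul_sum] at h4
    linarith [hsum n]
  have hlim' : Tendsto (fun n : ℕ => 1 + δ + 2 * ∑ i, (τ (P i * K ^ n * star (Z i))).re) atTop
      (𝓝 (1 + δ + 2 * ∑ _i : ι, 0)) :=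
    ((tendsto_finsetSum _ fun i _ => hlim i (Z i)).const_mul 2).const_add _
  simpa using ge_of_tendsto' hlim' hle

end Trace

/-! ### Tensor products of tracial states -/

section Tensor

variable {A : Type*} [Ring A] [StarRing A] [Algebra ℂ A] [StarModule ℂ A] {τ : A →ₗ[ℂ] ℂ}
variable {B : Type*} [Ring B] [StarRing B] [Algebra ℂ B] [StarModule ℂ B] {σ : B →ₗ[ℂ] ℂ}

/-- The product functional `τ ⊗ σ` on the algebraic tensor product. -/
def tensorTrace {A B : Type*} [Ring A] [Algebra ℂ A] [Ring B] [Algebra ℂ B]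
    (τ : A →ₗ[ℂ] ℂ) (σ : B →ₗ[ℂ] ℂ) : A ⊗[ℂ] B →ₗ[ℂ] ℂ :=
  LinearMap.mul' ℂ ℂ ∘ₗ TensorProduct.map τ σ

omit [StarRing A] [StarModule ℂ A] [StarRing B] [StarModule ℂ B] in
@[simp]
theorem tensorTrace_tmul (a : A) (b : B) : tensorTrace τ σ (a ⊗ₜ b) = τ a * σ b := by
  simp [tensorTrace]

open scoped ComplexOrder in
theorem IsTracialState.posSemidef_gram (hτ : IsTracialState τ) {ι : Type*} [Fintype ι] (a : ι → A) :
    (Matrix.of fun i j => τ (star (a i) * a j)).PosSemidef := by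
  rw [Matrix.posSemidef_iff_dotProduct_mulVec]
  refine ⟨?_, fun x => ?_⟩
  · ext i j
    simp only [Matrix.conjTranspose_apply, Matrix.of_apply]
    rw [← hτ.map_star, star_mul, star_star]
  · have h := hτ.map_star_mul_self (∑ i, x i • a i)
    have e : star x ⬝ᵥ (Matrix.of fun i j => τ (star (a i) * a j)).mulVec x =
        τ (star (∑ i, x i • a i) * ∑ i, x i • a i) := by
      simp only [dotProduct, Matrix.mulVec, Matrix.of_apply, star_sum, star_smul, Finset.sum_mul,
        Finset.mul_sum, map_sum, smul_mul_assoc, mul_smul_comm, map_smul, smul_eq_mul,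
        Pi.star_apply]
      rw [Finset.sum_comm]
      refine Finset.sum_congr rfl fun i _ => Finset.sum_congr rfl fun j _ => by ring
    rw [e, h]
    exact_mod_cast hτ.trSq_nonneg _

open scoped ComplexOrder in
/-- The product of tracial states is a tracial state; positivity is Schur's product theorem for
the Gram matrices of the two tensor factors. -/
theorem IsTracialState.tensor (hτ : IsTracialState τ) (hσ : IsTracialState σ) :
    IsTracialState (tensorTrace τ σ) where
  nonneg x := by
    obtain ⟨S, hS⟩ := TensorProduct.exists_finset x
    rw [← Finset.sum_coe_sort] at hS
    set a : S → A := fun i => i.1.1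
    set b : S → B := fun i => i.1.2
    replace hS : x = ∑ i, a i ⊗ₜ[ℂ] b i := hS
    rw [hS]
    have h := ((hτ.posSemidef_gram a).hadamard (hσ.posSemidef_gram b)).dotProduct_mulVec_nonneg 1
    have e : tensorTrace τ σ (star (∑ i, a i ⊗ₜ[ℂ] b i) * ∑ i, a i ⊗ₜ[ℂ] b i) =
        star 1 ⬝ᵥ (Matrix.hadamard (Matrix.of fun i j => τ (star (a i) * a j))
          (Matrix.of fun i j => σ (star (b i) * b j))).mulVec 1 := by
      simp only [dotProduct, Matrix.mulVec, Matrix.of_apply, star_sum, Finset.sum_mul,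
        Finset.mul_sum, map_sum, Matrix.hadamard_apply, Pi.star_apply, Pi.one_apply, star_one,
        one_mul, mul_one, TensorProduct.star_tmul, Algebra.TensorProduct.tmul_mul_tmul,
        tensorTrace_tmul]
      rw [Finset.sum_comm]
    rw [e]
    rw [Complex.le_def] at h
    exact ⟨h.1, h.2.symm⟩
  map_one := by
    rw [Algebra.TensorProduct.one_def, tensorTrace_tmul, hτ.map_one, hσ.map_one, one_mul]
  trace_comm x y := by
    induction x with
    | zero => simp
    | add x x' hx hx' => rw [add_mul, mul_add, map_add, map_add, hx, hx']
    | tmul a b =>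
      induction y with
      | zero => simp
      | add y y' hy hy' => rw [add_mul, mul_add, map_add, map_add, hy, hy']
      | tmul a' b' =>
        simp only [Algebra.TensorProduct.tmul_mul_tmul, tensorTrace_tmul]
        rw [hτ.trace_comm, hσ.trace_comm]

theorem IsTracialState.trSq_tmul (hτ : IsTracialState τ) (hσ : IsTracialState σ) (a : A) (b : B) :
    trSq (tensorTrace τ σ) (a ⊗ₜ b) = trSq τ a * trSq σ b := by
  rw [trSq, TensorProduct.star_tmul, Algebra.TensorProduct.tmul_mul_tmul, tensorTrace_tmul,
    hτ.map_star_mul_self, hσ.map_star_mul_self]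
  simp

theorem IsStarProjection.tmul {p : A} {q : B} (hp : IsStarProjection p) (hq : IsStarProjection q) :
    IsStarProjection (p ⊗ₜ[ℂ] q) where
  isIdempotentElem := by
    rw [IsIdempotentElem, Algebra.TensorProduct.tmul_mul_tmul, hp.isIdempotentElem.eq,
      hq.isIdempotentElem.eq]
  isSelfAdjoint := by
    rw [IsSelfAdjoint, TensorProduct.star_tmul, hp.isSelfAdjoint.star_eq, hq.isSelfAdjoint.star_eq]

/-- Approximate separation is multiplicative: a tensor product of separated elements is separated
from all elementary tensors with one of the two factors in the respective set. -/
theorem ApproxSeparated.tmul (hτ : IsTracialState τ) (hσ : IsTracialState σ) {P : A} {Q : B}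
    {S : Set A} {T : Set B} (hP : ApproxSeparated τ P S) (hQ : ApproxSeparated σ Q T) :
    ApproxSeparated (tensorTrace τ σ) (P ⊗ₜ[ℂ] Q)
      {x | ∃ a b, x = a ⊗ₜ[ℂ] b ∧ (a ∈ S ∨ b ∈ T)} := by
  intro ε hε
  have h1 : 0 < 2 * (trSq τ P + 1) := by linarith [hτ.trSq_nonneg P]
  obtain ⟨Z₂, hZ₂, hq₂⟩ := hQ (ε / 2 / (2 * (trSq τ P + 1))) (by positivity)
  have h2 : 0 < 2 * (trSq σ (Z₂ * Q) + 1) := by linarith [hσ.trSq_nonneg (Z₂ * Q)]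
  obtain ⟨Z₁, hZ₁, hq₁⟩ := hP (ε / 2 / (2 * (trSq σ (Z₂ * Q) + 1))) (by positivity)
  refine ⟨Z₁ ⊗ₜ Z₂, ?_, ?_⟩
  · rintro _ ⟨a, b, rfl, h | h⟩
    · rw [Algebra.TensorProduct.tmul_mul_tmul, hZ₁ a h, TensorProduct.zero_tmul]
    · rw [Algebra.TensorProduct.tmul_mul_tmul, hZ₂ b h, TensorProduct.tmul_zero]
  · have e : Z₁ ⊗ₜ[ℂ] Z₂ * P ⊗ₜ[ℂ] Q - P ⊗ₜ[ℂ] Q =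
        (Z₁ * P - P) ⊗ₜ (Z₂ * Q) + P ⊗ₜ (Z₂ * Q - Q) := by
      rw [Algebra.TensorProduct.tmul_mul_tmul, TensorProduct.sub_tmul, TensorProduct.tmul_sub]
      abel
    rw [lt_div_iff₀ h1] at hq₂
    rw [lt_div_iff₀ h2] at hq₁
    have h3 := (hτ.tensor hσ).trSq_add_le ((Z₁ * P - P) ⊗ₜ (Z₂ * Q)) (P ⊗ₜ (Z₂ * Q - Q))
    rw [hτ.trSq_tmul hσ, hτ.trSq_tmul hσ] at h3
    rw [e]
    nlinarith [hτ.trSq_nonneg (Z₁ * P - P), hσ.trSq_nonneg (Z₂ * Q - Q)]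

end Tensor

/-! ### Tracial representations over `*`-algebras -/

/-- The algebraic form of a tracial subspace representation: projections of trace `1 / lam` in a
tracial `*`-algebra, each approximately separated from those at its non-neighbours. -/
def HasAlgRep {V : Type w} (G : SimpleGraph V) (lam : ℝ) : Prop :=
  ∃ (M : Type v) (_ : Ring M) (_ : StarRing M) (_ : Algebra ℂ M) (_ : StarModule ℂ M)
    (τ : M →ₗ[ℂ] ℂ) (F : V → M), IsTracialState τ ∧ (∀ g, IsStarProjection (F g)) ∧
    (∀ g, ApproxSeparated τ (F g) (F '' Gᶜ.neighborSet g)) ∧ ∀ g, τ (F g) = ((1 / lam : ℝ) : ℂ)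

theorem ApproxSeparated.mono {A : Type*} [Ring A] [StarRing A] [Algebra ℂ A] {τ : A →ₗ[ℂ] ℂ}
    {P : A} {S T : Set A} (h : ApproxSeparated τ P T) (hST : S ⊆ T) : ApproxSeparated τ P S :=
  fun ε hε => (h ε hε).imp fun _ hZ => ⟨fun Q hQ => hZ.1 Q (hST hQ), hZ.2⟩

theorem strongPow_compl_adj {V : Type w} {G : SimpleGraph V} {k : ℕ} {a b : Fin k → V} :
    (strongPow G k)ᶜ.Adj a b ↔ ∃ i, Gᶜ.Adj (a i) (b i) := by
  simp only [SimpleGraph.compl_adj, strongPow]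
  constructor
  · rintro ⟨h1, h2⟩
    by_contra! h
    exact h2 ⟨h1, fun i => or_iff_not_imp_left.2 (h i)⟩
  · rintro ⟨i, h1, h2⟩
    exact ⟨fun h => h1 (congrFun h i), fun h => (h.2 i).elim h1 h2⟩

theorem HasAlgRep.strongPow {V : Type w} {G : SimpleGraph V} {lam : ℝ}
    (h : HasAlgRep.{v} G lam) (k : ℕ) : HasAlgRep.{v} (strongPow G k) (lam ^ k) := by
  obtain ⟨M, _, _, _, _, τ, F, hτ, hF, hsep, htr⟩ := h
  induction k with
  | zero =>
    refine ⟨M, _, _, _, inferInstance, τ, fun _ => 1, hτ, fun _ => .one _, fun g ε hε => ?_,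
      fun _ => by simp [hτ.map_one]⟩
    refine ⟨1, ?_, by simpa [trSq] using hε⟩
    rintro _ ⟨g', hg', rfl⟩
    obtain ⟨i, -⟩ := strongPow_compl_adj.1 hg'
    exact i.elim0
  | succ k ih =>
    obtain ⟨N, _, _, _, _, σ, E, hσ, hE, hsep', htr'⟩ := ih
    refine ⟨M ⊗[ℂ] N, _, _, _, inferInstance, tensorTrace τ σ,
      fun a => F (a 0) ⊗ₜ E (Fin.tail a), hτ.tensor hσ, fun a => (hF _).tmul (hE _), fun a => ?_,
      fun a => ?_⟩
    · refine ((hsep (a 0)).tmul hτ hσ (hsep' (Fin.tail a))).mono ?_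
      rintro _ ⟨b, hb, rfl⟩
      refine ⟨_, _, rfl, ?_⟩
      obtain ⟨i, hi⟩ := strongPow_compl_adj.1 hb
      induction i using Fin.cases with
      | zero => exact Or.inl ⟨_, hi, rfl⟩
      | succ i => exact Or.inr ⟨Fin.tail b, strongPow_compl_adj.2 ⟨i, hi⟩, rfl⟩
    · rw [tensorTrace_tmul, htr, htr', ← Complex.ofReal_mul, pow_succ', one_div_mul_one_div]

/-- Projections of a C*-algebra that sum to `1` are pairwise orthogonal: multiplying the sum by
`p g` from both sides shows that the positive elements `(p h * p g)* (p h * p g)`, `h ≠ g`, sum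
to `0`. -/
theorem mul_eq_zero_of_sum_eq_one {A : Type*} [CStarAlgebra A] {ι : Type*} [Fintype ι] {p : ι → A}
    (hp : ∀ g, IsStarProjection (p g)) (hsum : ∑ g, p g = 1) {g h : ι} (hgh : g ≠ h) :
    p g * p h = 0 := by
  classical
  let := CStarAlgebra.spectralOrder A
  have := CStarAlgebra.spectralOrderedRing A
  have hq (g' : ι) : star (p g' * p h) * (p g' * p h) = p h * p g' * p h := by
    rw [star_mul, (hp h).isSelfAdjoint.star_eq, (hp g').isSelfAdjoint.star_eq, mul_assoc,
      ← mul_assoc (p g'), (hp g').isIdempotentElem.eq, mul_assoc]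
  have h1 : ∑ g' ∈ Finset.univ.erase h, star (p g' * p h) * (p g' * p h) = 0 := by
    have h2 : ∑ g', p h * p g' * p h = p h := by
      rw [← Finset.sum_mul, ← Finset.mul_sum, hsum, mul_one, (hp h).isIdempotentElem.eq]
    rw [← Finset.add_sum_erase _ _ (Finset.mem_univ h), (hp h).isIdempotentElem.eq,
      (hp h).isIdempotentElem.eq, add_eq_left] at h2
    simpa only [hq] using h2
  rw [Finset.sum_eq_zero_iff_of_nonneg fun _ _ => star_mul_self_nonneg _] at h1
  exact CStarRing.star_mul_self_eq_zero_iff _ |>.1 (h1 g (by simp [hgh]))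

/-- A commuting quantum independent set of size `d` and a representation of parameter `lam` give
the projections `P i = ∑ g, E i g ⊗ F g` of trace `1 / lam`. They are approximately separated
from each other through `∑ g, E i g ⊗ Z g`, so `d / lam ≤ 1`. -/
theorem HasAlgRep.le_of_qcHom {V : Type w} [Fintype V] {G : SimpleGraph V} {lam : ℝ}
    (h : HasAlgRep.{v} G lam) (hlam : 0 < lam) {d : ℕ}
    (hd : QCHom.{u} (⊤ : SimpleGraph (Fin d)) Gᶜ) : (d : ℝ) ≤ lam := by
  classical
  obtain ⟨M, _, _, _, _, σ, F, hσ, hF, hsep, htr⟩ := h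
  obtain ⟨A, _, τ, E, hτ, hE, hsum, horth⟩ := hd
  have hEE (i : Fin d) {g g' : V} (hg : g ≠ g') : E i g * E i g' = 0 :=
    mul_eq_zero_of_sum_eq_one (hE i) (hsum i) hg
  set P : Fin d → A ⊗[ℂ] M := fun i => ∑ g, E i g ⊗ₜ[ℂ] F g with hP_def
  have hmul (i j : Fin d) (Z : V → M) : (∑ g, E i g ⊗ₜ[ℂ] Z g) * P j =
      ∑ g, ∑ g', (E i g * E j g') ⊗ₜ[ℂ] (Z g * F g') := by
    simp only [hP_def, Finset.sum_mul, Finset.mul_sum, Algebra.TensorProduct.tmul_mul_tmul]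
    rw [Finset.sum_comm]
  have hmul_self (i : Fin d) (Z : V → M) : (∑ g, E i g ⊗ₜ[ℂ] Z g) * P i =
      ∑ g, E i g ⊗ₜ[ℂ] (Z g * F g) := by
    rw [hmul]
    refine Finset.sum_congr rfl fun g _ => ?_
    rw [Finset.sum_eq_single g (fun g' _ hg' => by rw [hEE i hg'.symm, TensorProduct.zero_tmul])
      (by simp), (hE i g).isIdempotentElem.eq]
  have hP (i : Fin d) : IsStarProjection (P i) := by
    constructor
    · rw [IsIdempotentElem, hP_def, hmul_self]
      exact Finset.sum_congr rfl fun g _ => by rw [(hF g).isIdempotentElem.eq]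
    · rw [IsSelfAdjoint, hP_def, star_sum]
      exact Finset.sum_congr rfl fun g _ => ((hE i g).tmul (hF g)).isSelfAdjoint
  have htrE (i : Fin d) : ∑ g, τ (E i g) = 1 := by rw [← map_sum, hsum, hτ.map_one]
  have hPtr (i : Fin d) : (tensorTrace τ σ (P i)).re = 1 / lam := by
    rw [hP_def, map_sum]
    simp only [tensorTrace_tmul, htr]
    rw [← Finset.sum_mul, htrE, one_mul, Complex.ofReal_re]
  have hsepP (i : Fin d) : ApproxSeparated (tensorTrace τ σ) (P i) {Q | ∃ j, j ≠ i ∧ Q = P j} := by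
    intro ε hε
    choose Z hZ0 hZε using fun g => hsep g (ε / 2) (by positivity)
    refine ⟨∑ g, E i g ⊗ₜ[ℂ] Z g, ?_, ?_⟩
    · rintro _ ⟨j, hj, rfl⟩
      rw [hmul]
      refine Finset.sum_eq_zero fun g _ => Finset.sum_eq_zero fun g' _ => ?_
      by_cases h : Gᶜ.Adj g g'
      · rw [hZ0 g _ ⟨g', h, rfl⟩, TensorProduct.tmul_zero]
      · have h' : Gᶜᶜ.Adj g g' ∨ g = g' := by
          rw [SimpleGraph.compl_adj]; tauto
        rw [horth i j g g' hj.symm h', TensorProduct.zero_tmul]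
    · -- The summands of the error are pairwise orthogonal, so their squared norms add up.
      have e : (∑ g, E i g ⊗ₜ[ℂ] Z g) * P i - P i = ∑ g, E i g ⊗ₜ[ℂ] (Z g * F g - F g) := by
        rw [hmul_self, hP_def, ← Finset.sum_sub_distrib]
        exact Finset.sum_congr rfl fun g _ => (TensorProduct.tmul_sub _ _ _).symm
      have e2 : trSq (tensorTrace τ σ) (∑ g, E i g ⊗ₜ[ℂ] (Z g * F g - F g)) =
          ∑ g, (τ (E i g)).re * trSq σ (Z g * F g - F g) := by
        rw [trSq, star_sum, Finset.sum_mul, map_sum, Complex.re_sum]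
        refine Finset.sum_congr rfl fun g _ => ?_
        rw [Finset.mul_sum, Finset.sum_eq_single g]
        · rw [TensorProduct.star_tmul, Algebra.TensorProduct.tmul_mul_tmul, tensorTrace_tmul,
            hσ.map_star_mul_self, (hE i g).isSelfAdjoint.star_eq, (hE i g).isIdempotentElem.eq,
            Complex.re_mul_ofReal]
        · intro g' _ hg'
          rw [TensorProduct.star_tmul, Algebra.TensorProduct.tmul_mul_tmul,
            (hE i g).isSelfAdjoint.star_eq, hEE i hg'.symm, TensorProduct.zero_tmul]
        · simp
      have htrE' : ∑ g, (τ (E i g)).re = 1 := by rw [← Complex.re_sum, htrE]; simp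
      calc trSq (tensorTrace τ σ) ((∑ g, E i g ⊗ₜ[ℂ] Z g) * P i - P i)
          = ∑ g, (τ (E i g)).re * trSq σ (Z g * F g - F g) := by rw [e, e2]
        _ ≤ ∑ g, (τ (E i g)).re * (ε / 2) := by
          refine Finset.sum_le_sum fun g _ => mul_le_mul_of_nonneg_left (hZε g).le ?_
          have := hτ.isTracePos_projection (hE i g) 1
          rwa [star_one, one_mul, mul_one] at this
        _ = ε / 2 := by rw [← Finset.sum_mul, htrE', one_mul]
        _ < ε := half_lt_self hε
  have h := (hτ.tensor hσ).sum_trace_le_one hP hsepP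
  simp only [hPtr, Finset.sum_const, Finset.card_univ, Fintype.card_fin, nsmul_eq_mul] at h
  rwa [mul_one_div, div_le_one hlam] at h

/-! ### From von Neumann algebras to approximate separation -/

section Hilbert

variable {H : Type v} [NormedAddCommGroup H] [InnerProductSpace ℂ H] [CompleteSpace H]

theorem inner_apply_left_of_isSelfAdjoint {T : H →L[ℂ] H} (hT : IsSelfAdjoint T) (x y : H) :
    inner ℂ (T x) y = inner ℂ x (T y) :=
  ContinuousLinearMap.isSelfAdjoint_iff_isSymmetric.1 hT x y

omit [CompleteSpace H] in
theorem antitone_norm_pow_apply {T : H →L[ℂ] H} (hT1 : ‖T‖ ≤ 1) (x : H) :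
    Antitone fun n => ‖(T ^ n) x‖ ^ 2 := antitone_nat_of_succ_le fun n => by
  have := T.le_of_opNorm_le hT1 ((T ^ n) x)
  rw [one_mul, ← mul_apply_eq_comp, ← pow_succ'] at this
  exact pow_le_pow_left₀ (norm_nonneg _) this 2

/-- Powers of a self-adjoint contraction `T` tend strongly to `0` if `T ^ 2` fixes no nonzero
vector: by the mean ergodic theorem the averages of `‖T ^ k x‖ ^ 2 = ⟪T ^ (2 * k) x, x⟫` tend to
`0`, and this sequence is antitone. -/
theorem tendsto_norm_pow_apply_zero {T : H →L[ℂ] H} (hT : IsSelfAdjoint T) (hT1 : ‖T‖ ≤ 1)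
    (hfix : ∀ x, T (T x) = x → x = 0) (x : H) :
    Tendsto (fun n => ‖(T ^ n) x‖ ^ 2) atTop (𝓝 0) := by
  have hanti := antitone_norm_pow_apply hT1 x
  have hpow (k : ℕ) : RCLike.re (inner ℂ (((T ^ 2) ^ k) x) x) = ‖(T ^ k) x‖ ^ 2 := by
    rw [← pow_mul, two_mul, pow_add, mul_apply_eq_comp,
      inner_apply_left_of_isSelfAdjoint (hT.pow k), inner_self_eq_norm_sq]
  have h := (T ^ 2).tendsto_birkhoffAverage_orthogonalProjection
    ((norm_pow_le' T two_pos).trans (pow_le_one₀ (norm_nonneg _) hT1)) x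
  have hz : (((T ^ 2).eqLocus (1 : H →L[ℂ] H)).orthogonalProjectionOnto x : H) = 0 := by
    refine hfix _ ?_
    have h0 := LinearMap.mem_eqLocus.1
      (((T ^ 2).eqLocus (1 : H →L[ℂ] H)).orthogonalProjectionOnto x).2
    rw [sq] at h0
    exact h0
  rw [hz] at h
  have h2 : Tendsto
      (fun n => RCLike.re (inner ℂ (birkhoffAverage ℂ ⇑(T ^ 2) _root_.id (n + 1) x) x))
      atTop (𝓝 0) := by
    have := RCLike.continuous_re.tendsto _ |>.comp
      ((h.comp (tendsto_add_atTop_nat 1)).inner (tendsto_const_nhds (x := x)) (𝕜 := ℂ))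
    simpa only [Function.comp_def, inner_zero_left, map_zero] using this
  have h3 (n : ℕ) : ‖(T ^ (n + 1)) x‖ ^ 2 ≤
      RCLike.re (inner ℂ (birkhoffAverage ℂ ⇑(T ^ 2) _root_.id (n + 1) x) x) := by
    have e : RCLike.re (inner ℂ (birkhoffAverage ℂ ⇑(T ^ 2) _root_.id (n + 1) x) x) =
        ((n + 1 : ℕ) : ℝ)⁻¹ * ∑ k ∈ Finset.range (n + 1), ‖(T ^ k) x‖ ^ 2 := by
      have hc : (starRingEnd ℂ) (((n + 1 : ℕ) : ℂ)⁻¹) = ((((n + 1 : ℕ) : ℝ)⁻¹ : ℝ) : ℂ) := by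
        rw [map_inv₀, Complex.conj_natCast]; push_cast; rfl
      rw [birkhoffAverage, birkhoffSum, inner_smul_left, hc, RCLike.re_eq_complex_re,
        Complex.re_ofReal_mul, sum_inner, Complex.re_sum]
      congr 1
      refine Finset.sum_congr rfl fun k _ => ?_
      rw [← hpow k, ← FunLike.coe_pow_eq_iterate]
      rfl
    rw [e, inv_mul_eq_div, le_div_iff₀ (by positivity), mul_comm, ← nsmul_eq_mul]
    calc (n + 1) • ‖(T ^ (n + 1)) x‖ ^ 2 =
        (Finset.range (n + 1)).card • ‖(T ^ (n + 1)) x‖ ^ 2 := by rw [Finset.card_range]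
      _ ≤ _ := Finset.card_nsmul_le_sum _ _ _ fun k hk => hanti (Finset.mem_range.1 hk).le
  exact (tendsto_add_atTop_iff_nat 1).1 (squeeze_zero (fun n => by positivity) h3 h2)

theorem IsStarProjection.apply_eq_self_of_norm_le {P : H →L[ℂ] H} (hP : IsStarProjection P)
    {x : H} (h : ‖x‖ ≤ ‖P x‖) : P x = x := by
  obtain ⟨_, hP'⟩ := isStarProjection_iff_eq_starProjection_range.1 hP
  rw [hP'] at h ⊢
  rw [Submodule.starProjection_eq_self_iff, Submodule.mem_iff_norm_starProjection]
  exact le_antisymm (Submodule.norm_starProjection_apply_le _ _) h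

theorem IsStarProjection.norm_apply_le {P : H →L[ℂ] H} (hP : IsStarProjection P) (x : H) :
    ‖P x‖ ≤ ‖x‖ := by
  obtain ⟨_, hP'⟩ := isStarProjection_iff_eq_starProjection_range.1 hP
  rw [hP']
  exact Submodule.norm_starProjection_apply_le _ _

theorem isStarProjection_projJoin {ι : Type w} (s : Set ι) (P : ι → H →L[ℂ] H) :
    IsStarProjection (projJoin s P) :=
  isStarProjection_starProjection

theorem projJoin_mul {ι : Type w} {s : Set ι} {P : ι → H →L[ℂ] H} {i : ι} (hi : i ∈ s) :
    projJoin s P * P i = P i := by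
  ext x
  refine Submodule.starProjection_eq_self_iff.2 (Submodule.le_topologicalClosure _ ?_)
  exact Submodule.mem_iSup_of_mem i (Submodule.mem_iSup_of_mem hi ⟨x, rfl⟩)

/-- A von Neumann algebra contains the joins of its projections, since the commutant preserves the
closed span of their ranges. -/
theorem projJoin_mem (M : VonNeumannAlgebra H) {ι : Type w} {s : Set ι} {P : ι → H →L[ℂ] H}
    (hP : ∀ i ∈ s, P i ∈ M) : projJoin s P ∈ M := by
  refine (VonNeumannAlgebra.IsStarProjection.mem_iff
    (isStarProjection_projJoin s P) M).2 fun y hy => ?_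
  rw [Module.End.mem_invtSubmodule]
  have hr : (projJoin s P).range = (⨆ i ∈ s, (P i).range).topologicalClosure :=
    Submodule.range_starProjection _
  rw [hr]
  refine Submodule.topologicalClosure_minimal _ ?_
    ((Submodule.isClosed_topologicalClosure _).preimage y.continuous)
  refine iSup₂_le fun i hi => ?_
  rintro _ ⟨z, rfl⟩
  refine Submodule.le_topologicalClosure _ ?_
  refine Submodule.mem_iSup_of_mem i (Submodule.mem_iSup_of_mem hi ⟨y z, ?_⟩)
  have := VonNeumannAlgebra.mem_commutant_iff.1 hy _ (hP i hi)
  exact congrArg (· z) this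

theorem eq_zero_of_projMeet_eq_zero {P Q : H →L[ℂ] H} (h : projMeet P Q = 0) {x : H}
    (hP : P x = x) (hQ : Q x = x) : x = 0 := by
  have hx : projMeet P Q x = x := Submodule.starProjection_eq_self_iff.2
    (Submodule.le_topologicalClosure _ ⟨⟨x, hP⟩, ⟨x, hQ⟩⟩)
  rw [← hx, h]; rfl

/-- Normality turns the strong convergence of `1 - T ^ (2 * n)` to `1` into the convergence of
`‖T ^ n‖₂² = τ (T ^ (2 * n))` to `0`. -/
theorem IsNormalFunctional.tendsto_trSq_pow {M : VonNeumannAlgebra H}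
    {τ : M.toStarSubalgebra →ₗ[ℂ] ℂ} (hτ : IsNormalFunctional M τ) {T : M.toStarSubalgebra}
    (hT : IsSelfAdjoint T) (hT1 : ‖(T : H →L[ℂ] H)‖ ≤ 1)
    (hfix : ∀ x, (T : H →L[ℂ] H) ((T : H →L[ℂ] H) x) = x → x = 0) :
    Tendsto (fun n => trSq τ (T ^ n)) atTop (𝓝 0) := by
  set S : H →L[ℂ] H := (T : H →L[ℂ] H) with hS_def
  have hS : IsSelfAdjoint S := congrArg Subtype.val hT
  have hle {m n : ℕ} (h : m ≤ n) : S ^ (2 * n) ≤ S ^ (2 * m) := by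
    rw [ContinuousLinearMap.le_def, ContinuousLinearMap.isPositive_def']
    refine ⟨(hS.pow _).sub (hS.pow _), fun x => ?_⟩
    have hpow (k : ℕ) : RCLike.re (inner ℂ ((S ^ (2 * k)) x) x) = ‖(S ^ k) x‖ ^ 2 := by
      rw [two_mul, pow_add, mul_apply_eq_comp, inner_apply_left_of_isSelfAdjoint (hS.pow k),
        inner_self_eq_norm_sq]
    rw [ContinuousLinearMap.reApplyInnerSelf_apply, sub_apply, inner_sub_left,
      map_sub, hpow, hpow, sub_nonneg]
    exact antitone_norm_pow_apply hT1 x h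
  have hval (n : ℕ) : ((1 - T ^ (2 * n) : M.toStarSubalgebra) : H →L[ℂ] H) = 1 - S ^ (2 * n) := rfl
  -- The increasing net of the `1 - T ^ (2 * n)`, indexed by `ℕ` in the universe of `H`.
  have h := hτ (ULift.{v} ℕ) (fun n => 1 - T ^ (2 * n.down)) 1
    (fun n => by
      rw [hval, sub_nonneg]
      simpa using hle (Nat.zero_le n.down))
    (fun m n hmn => by
      rw [hval, hval]
      exact sub_le_sub_left (hle hmn) 1)
    (fun η => by
      have h0 : Tendsto (fun n : ℕ => (S ^ (2 * n)) η) atTop (𝓝 0) := by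
        have h1 := (tendsto_norm_pow_apply_zero hS hT1 hfix η).sqrt
        simp only [Real.sqrt_sq (norm_nonneg _), Real.sqrt_zero] at h1
        exact (tendsto_zero_iff_norm_tendsto_zero.2 h1).comp
          (tendsto_id.const_mul_atTop' (by norm_num))
      have h1 := (tendsto_const_nhds (x := η)).sub (h0.comp (tendsto_atTop.2 fun b =>
        (eventually_ge_atTop (ULift.up.{v} b)).mono fun _ hn => hn))
      rw [sub_zero] at h1
      exact h1)
  have h1 : Tendsto (fun n : ℕ => τ (1 - T ^ (2 * n))) atTop (𝓝 (τ 1)) :=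
    h.comp (f := ULift.up)
      (tendsto_atTop.2 fun b => (eventually_ge_atTop b.down).mono fun _ hn => hn)
  have h2 := (Complex.continuous_re.tendsto _).comp ((tendsto_const_nhds (x := τ 1)).sub h1)
  simp only [Function.comp_def, map_sub, sub_sub_cancel, sub_self, Complex.zero_re] at h2
  refine h2.congr fun n => ?_
  rw [trSq, (hT.pow n).star_eq, ← pow_add, two_mul]

end Hilbert

/-- With `B` the join of the other projections and `T = E g * B * E g`, the elements
`(∑ k < n, T ^ k) * E g * (1 - B)` annihilate those projections and fix `E g` up to `T ^ n`. -/
theorem HasTracialSubspaceRep.hasAlgRep {V : Type w} {G : SimpleGraph V} {lam : ℝ}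
    (h : HasTracialSubspaceRep.{v} G lam) : HasAlgRep.{v} G lam := by
  obtain ⟨H, _, _, _, M, τ, E, hτ, hn, hE, hmeet, htr⟩ := h
  refine ⟨M.toStarSubalgebra, _, _, _, inferInstance, τ, E, hτ, hE, fun g ε hε => ?_, htr⟩
  have hE' (g : V) : IsStarProjection (E g : H →L[ℂ] H) :=
    ⟨congrArg Subtype.val (hE g).isIdempotentElem, congrArg Subtype.val (hE g).isSelfAdjoint⟩
  set B₀ := projJoin (Gᶜ.neighborSet g) (fun g' => (E g' : H →L[ℂ] H)) with hB₀
  have hB₀p : IsStarProjection B₀ := isStarProjection_projJoin _ _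
  obtain ⟨B, hBB⟩ : ∃ B : M.toStarSubalgebra, (B : H →L[ℂ] H) = B₀ :=
    ⟨⟨B₀, projJoin_mem M fun g' _ => (E g').2⟩, rfl⟩
  have hB : IsSelfAdjoint B := Subtype.ext (by
    have := hB₀p.isSelfAdjoint.star_eq
    rwa [← hBB] at this)
  set F := E g with hF
  have hFs := (hE g).isSelfAdjoint
  have hFF : F * F = F := (hE g).isIdempotentElem.eq
  set T := F * B * F with hT_def
  have hT : IsSelfAdjoint T := by
    rw [IsSelfAdjoint, hT_def, star_mul, star_mul, hB.star_eq, hFs.star_eq, mul_assoc]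
  have hTapp (x : H) : (T : H →L[ℂ] H) x =
      (F : H →L[ℂ] H) (B₀ ((F : H →L[ℂ] H) x)) := by rw [← hBB]; rfl
  have hTle (x : H) : ‖(T : H →L[ℂ] H) x‖ ≤ ‖B₀ ((F : H →L[ℂ] H) x)‖ := by
    rw [hTapp]; exact (hE' g).norm_apply_le _
  have hle (x : H) : ‖(T : H →L[ℂ] H) x‖ ≤ ‖x‖ :=
    (hTle x).trans ((hB₀p.norm_apply_le _).trans ((hE' g).norm_apply_le x))
  have hlim := hn.tendsto_trSq_pow hT
    (ContinuousLinearMap.opNorm_le_bound _ zero_le_one fun x => by rw [one_mul]; exact hle x)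
    (fun x hx => by
      have h1 : ‖x‖ ≤ ‖B₀ ((F : H →L[ℂ] H) x)‖ := by
        calc ‖x‖ = ‖(T : H →L[ℂ] H) ((T : H →L[ℂ] H) x)‖ := by rw [hx]
          _ ≤ ‖(T : H →L[ℂ] H) x‖ := hle _
          _ ≤ _ := hTle x
      have h2 : (F : H →L[ℂ] H) x = x :=
        (hE' g).apply_eq_self_of_norm_le (h1.trans (hB₀p.norm_apply_le _))
      rw [h2] at h1
      exact eq_zero_of_projMeet_eq_zero (hmeet g) h2 (hB₀p.apply_eq_self_of_norm_le h1))
  obtain ⟨n, hn1, hn0⟩ := ((hlim.eventually (gt_mem_nhds hε)).and (eventually_gt_atTop 0)).exists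
  refine ⟨(∑ k ∈ Finset.range n, T ^ k) * F * (1 - B), ?_, ?_⟩
  · rintro _ ⟨g', hg', rfl⟩
    have : B * E g' = E g' := Subtype.ext (by
      have := projJoin_mul (P := fun g' => (E g' : H →L[ℂ] H)) hg'
      rwa [← hB₀, ← hBB] at this)
    rw [mul_assoc, sub_mul, one_mul, this, sub_self, mul_zero]
  · have hTF : T * F = T := by rw [hT_def, mul_assoc, hFF]
    have e : (∑ k ∈ Finset.range n, T ^ k) * F * (1 - B) * F - F = -T ^ n := by
      have hFT : F * (1 - B) * F = (1 - T) * F := by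
        rw [sub_mul 1 T, hTF, mul_sub, mul_one, sub_mul, hFF, one_mul]
      have hTn : T ^ n * F = T ^ n := by
        obtain ⟨m, rfl⟩ := Nat.exists_eq_succ_of_ne_zero hn0.ne'
        rw [pow_succ, mul_assoc, hTF]
      rw [mul_assoc, mul_assoc, ← mul_assoc F, hFT, ← mul_assoc, geom_sum_mul_neg, sub_mul, one_mul,
        hTn]
      abel
    rw [e, trSq, star_neg, neg_mul_neg]
    exact hn1

/-! ### The Gelfand–Naimark–Segal construction for tracial `*`-algebras -/

section GNS

variable {A : Type u} [Ring A] [StarRing A] [Algebra ℂ A] [StarModule ℂ A] {τ : A →ₗ[ℂ] ℂ}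

/-- The algebra `A` as a semi-inner product space, with `⟪a, b⟫ = τ (a* b)`. -/
def TraceSpace (_hτ : IsTracialState τ) : Type u := A

variable (hτ : IsTracialState τ)

instance : AddCommGroup (TraceSpace hτ) := inferInstanceAs (AddCommGroup A)

instance : Module ℂ (TraceSpace hτ) := inferInstanceAs (Module ℂ A)

/-- The semi-inner product `IsTracialState.core` on `TraceSpace`. -/
abbrev TraceSpace.core : PreInnerProductSpace.Core ℂ (TraceSpace hτ) where
  inner := hτ.core.inner
  conj_inner_symm := hτ.core.conj_inner_symm
  re_inner_nonneg := hτ.core.re_inner_nonneg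
  add_left := hτ.core.add_left
  smul_left := hτ.core.smul_left

instance : SeminormedAddCommGroup (TraceSpace hτ) :=
  InnerProductSpace.Core.toSeminormedAddCommGroup (c := TraceSpace.core hτ)

instance : InnerProductSpace ℂ (TraceSpace hτ) := InnerProductSpace.ofCore (TraceSpace.core hτ)

/-- The Hilbert space of the trace: the completion of `A`. -/
abbrev TraceHilbert : Type u := UniformSpace.Completion (TraceSpace hτ)

/-- The canonical linear map from `A` to the Hilbert space of the trace. -/
def toTraceHilbert : A →ₗ[ℂ] TraceHilbert hτ :=
  (UniformSpace.Completion.toComplL (𝕜 := ℂ) (E := TraceSpace hτ)).toLinearMap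

theorem inner_toTraceHilbert (a b : A) :
    inner ℂ (toTraceHilbert hτ a) (toTraceHilbert hτ b) = τ (star a * b) :=
  UniformSpace.Completion.inner_coe (𝕜 := ℂ) (E := TraceSpace hτ) a b

theorem denseRange_toTraceHilbert : DenseRange (toTraceHilbert hτ) :=
  UniformSpace.Completion.denseRange_coe (α := TraceSpace hτ)

/-- The bounded operator `x` extends left multiplication by `a`. -/
def IsLeftMul (x : TraceHilbert hτ →L[ℂ] TraceHilbert hτ) (a : A) : Prop :=
  ∀ z : A, x (toTraceHilbert hτ z) = toTraceHilbert hτ (a * z)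

variable {hτ}

theorem IsLeftMul.unique {x y : TraceHilbert hτ →L[ℂ] TraceHilbert hτ} {a : A}
    (hx : IsLeftMul hτ x a) (hy : IsLeftMul hτ y a) : x = y := by
  refine DFunLike.coe_injective ((denseRange_toTraceHilbert hτ).equalizer x.continuous y.continuous
    (funext fun z => ?_))
  exact (hx z).trans (hy z).symm

theorem IsLeftMul.add {x y : TraceHilbert hτ →L[ℂ] TraceHilbert hτ} {a b : A}
    (hx : IsLeftMul hτ x a) (hy : IsLeftMul hτ y b) : IsLeftMul hτ (x + y) (a + b) := fun z => by
  rw [add_apply, hx, hy, add_mul, map_add]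

theorem IsLeftMul.mul {x y : TraceHilbert hτ →L[ℂ] TraceHilbert hτ} {a b : A}
    (hx : IsLeftMul hτ x a) (hy : IsLeftMul hτ y b) : IsLeftMul hτ (x * y) (a * b) := fun z => by
  rw [mul_apply_eq_comp, hy, hx, mul_assoc]

theorem IsLeftMul.algebraMap (r : ℂ) : IsLeftMul hτ
    (algebraMap ℂ (TraceHilbert hτ →L[ℂ] TraceHilbert hτ) r) (algebraMap ℂ A r) := fun z => by
  rw [← Algebra.smul_def, map_smul, Algebra.algebraMap_eq_smul_one]
  rfl

theorem IsLeftMul.zero : IsLeftMul hτ 0 0 := fun z => by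
  rw [zero_mul, map_zero]; rfl

theorem IsLeftMul.one : IsLeftMul hτ 1 1 := fun z => by
  rw [one_mul]; rfl

theorem IsLeftMul.sum {ι : Type*} {s : Finset ι} {x : ι → TraceHilbert hτ →L[ℂ] TraceHilbert hτ}
    {a : ι → A} (h : ∀ i, IsLeftMul hτ (x i) (a i)) :
    IsLeftMul hτ (∑ i ∈ s, x i) (∑ i ∈ s, a i) := by
  classical
  induction s using Finset.induction_on with
  | empty => simpa using IsLeftMul.zero
  | insert i s hi ih => rw [Finset.sum_insert hi, Finset.sum_insert hi]; exact (h i).add ih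

/-- Left multiplication by a projection is contractive for the trace norm, so it extends to a
projection on the Hilbert space of the trace. -/
theorem exists_isLeftMul_projection (hτ : IsTracialState τ) {p : A} (hp : IsStarProjection p) :
    ∃ x : TraceHilbert hτ →L[ℂ] TraceHilbert hτ, IsStarProjection x ∧ IsLeftMul hτ x p := by
  have hbound (z : A) : trSq τ (p * z) ≤ trSq τ z := by
    have h := hτ.isTracePos_projection hp.one_sub z
    have e : star (p * z) * (p * z) = star z * p * z := by
      rw [star_mul, hp.isSelfAdjoint.star_eq, mul_assoc, ← mul_assoc p p,
        hp.isIdempotentElem.eq, mul_assoc]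
    rw [mul_sub, sub_mul, mul_one, map_sub, Complex.sub_re, ← e] at h
    exact sub_nonneg.1 h
  let m : TraceSpace hτ →L[ℂ] TraceSpace hτ :=
    LinearMap.mkContinuous (E := TraceSpace hτ) (F := TraceSpace hτ)
        (LinearMap.mulLeft ℂ p) 1 fun z => by
      rw [one_mul]
      exact Real.sqrt_le_sqrt (hbound z)
  have hm : IsLeftMul hτ m.completion p := fun z => by
    exact ContinuousLinearMap.completion_apply_coe m z
  refine ⟨m.completion, ⟨?_, ?_⟩, hm⟩
  · exact (hm.mul hm).unique (by rwa [hp.isIdempotentElem.eq])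
  · rw [ContinuousLinearMap.isSelfAdjoint_iff_isSymmetric]
    intro v w
    refine (denseRange_toTraceHilbert hτ).induction_on₂ (p := fun v w =>
      inner ℂ (m.completion v) w = inner ℂ v (m.completion w)) ?_ (fun a b => ?_) v w
    · exact isClosed_eq (by fun_prop) (by fun_prop)
    · rw [hm, hm, inner_toTraceHilbert, inner_toTraceHilbert, star_mul, hp.isSelfAdjoint.star_eq,
        mul_assoc]

variable (hτ) in
/-- The `*`-algebra of bounded operators that extend left multiplications. -/
def leftMulAlgebra : StarSubalgebra ℂ (TraceHilbert hτ →L[ℂ] TraceHilbert hτ) where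
  carrier := {x | ∃ a, IsLeftMul hτ x a ∧ IsLeftMul hτ (star x) (star a)}
  mul_mem' := by
    rintro x y ⟨a, ha, ha'⟩ ⟨b, hb, hb'⟩
    exact ⟨a * b, ha.mul hb, by rw [star_mul, star_mul]; exact hb'.mul ha'⟩
  add_mem' := by
    rintro x y ⟨a, ha, ha'⟩ ⟨b, hb, hb'⟩
    exact ⟨a + b, ha.add hb, by rw [star_add, star_add]; exact ha'.add hb'⟩
  algebraMap_mem' r := ⟨algebraMap ℂ A r, .algebraMap r, by
    rw [← algebraMap_star_comm, ← algebraMap_star_comm]; exact .algebraMap _⟩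
  star_mem' := by
    rintro x ⟨a, ha, ha'⟩
    exact ⟨star a, ha', by rwa [star_star, star_star]⟩

variable (hτ) in
/-- The vector functional `x ↦ ⟪1, x 1⟫` of the unit of `A`. -/
def vectorTrace : (TraceHilbert hτ →L[ℂ] TraceHilbert hτ) →L[ℂ] ℂ :=
  (innerSL ℂ (toTraceHilbert hτ 1)).comp
    (ContinuousLinearMap.apply ℂ (TraceHilbert hτ) (toTraceHilbert hτ 1))

theorem IsLeftMul.vectorTrace_eq {x : TraceHilbert hτ →L[ℂ] TraceHilbert hτ} {a : A}
    (hx : IsLeftMul hτ x a) : vectorTrace hτ x = τ a := by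
  have : vectorTrace hτ x = inner ℂ (toTraceHilbert hτ 1) (x (toTraceHilbert hτ 1)) := rfl
  rw [this, hx, inner_toTraceHilbert, star_one, one_mul, mul_one]

theorem vectorTrace_star_mul_self (x : TraceHilbert hτ →L[ℂ] TraceHilbert hτ) :
    vectorTrace hτ (star x * x) = ((‖x (toTraceHilbert hτ 1)‖ ^ 2 : ℝ) : ℂ) := by
  refine (ContinuousLinearMap.adjoint_inner_right x _ _).trans
    ((inner_self_eq_norm_sq_to_K (𝕜 := ℂ) (x (toTraceHilbert hτ 1))).trans ?_)
  simp

theorem vectorTrace_mul_comm {x y : TraceHilbert hτ →L[ℂ] TraceHilbert hτ}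
    (hx : x ∈ (leftMulAlgebra hτ).topologicalClosure)
    (hy : y ∈ (leftMulAlgebra hτ).topologicalClosure) :
    vectorTrace hτ (x * y) = vectorTrace hτ (y * x) := by
  have hclosed (y : TraceHilbert hτ →L[ℂ] TraceHilbert hτ) :
      IsClosed {x | vectorTrace hτ (x * y) = vectorTrace hτ (y * x)} :=
    isClosed_eq (by fun_prop) (by fun_prop)
  have h1 {y} (hy : y ∈ leftMulAlgebra hτ) {x} (hx : x ∈ (leftMulAlgebra hτ).topologicalClosure) :
      vectorTrace hτ (x * y) = vectorTrace hτ (y * x) := by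
    refine closure_minimal (s := (leftMulAlgebra hτ : Set _)) ?_ (hclosed y)
      (show x ∈ closure (leftMulAlgebra hτ : Set _) from hx)
    rintro x ⟨a, ha, -⟩
    obtain ⟨b, hb, -⟩ := hy
    exact ((ha.mul hb).vectorTrace_eq.trans (hτ.trace_comm a b)).trans
      (hb.mul ha).vectorTrace_eq.symm
  refine (closure_minimal (s := (leftMulAlgebra hτ : Set _)) ?_ (hclosed x)
    (show y ∈ closure (leftMulAlgebra hτ : Set _) from hy)).symm
  exact fun y hy => (h1 hy hx).symm

/-- For a commuting quantum homomorphism it is enough to have the projections in a tracial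
`*`-algebra: the norm closure of the bounded left multiplications on the Hilbert space of the
trace is a C*-algebra, and its vector state at `1` is tracial. -/
theorem QCHom.of_tracialAlgebra {V : Type w} {W : Type x} [Fintype W] {G : SimpleGraph V}
    {H : SimpleGraph W} (hτ : IsTracialState τ) {E : V → W → A}
    (hE : ∀ g h, IsStarProjection (E g h)) (hsum : ∀ g, ∑ h, E g h = 1)
    (horth : ∀ g g' h h', G.Adj g g' → (Hᶜ.Adj h h' ∨ h = h') → E g h * E g' h' = 0) :
    QCHom.{u} G H := by
  choose X hXp hX using fun g h => exists_isLeftMul_projection hτ (hE g h)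
  let N := (leftMulAlgebra hτ).topologicalClosure
  have : IsClosed (N : Set (TraceHilbert hτ →L[ℂ] TraceHilbert hτ)) :=
    (leftMulAlgebra hτ).isClosed_topologicalClosure
  have hmem (g h) : X g h ∈ N := (leftMulAlgebra hτ).le_topologicalClosure
    ⟨E g h, hX g h, by
      rw [(hXp g h).isSelfAdjoint.star_eq, (hE g h).isSelfAdjoint.star_eq]; exact hX g h⟩
  refine ⟨N, inferInstance, (vectorTrace hτ).toLinearMap ∘ₗ N.subtype.toAlgHom.toLinearMap,
    fun g h => ⟨X g h, hmem g h⟩, ⟨fun a => ?_, ?_, fun a b => ?_⟩, fun g h => ⟨?_, ?_⟩,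
    fun g => ?_, fun g g' h h' hg hh => ?_⟩
  · have e' : ((vectorTrace hτ).toLinearMap ∘ₗ N.subtype.toAlgHom.toLinearMap) (star a * a) =
        vectorTrace hτ (star (a : TraceHilbert hτ →L[ℂ] TraceHilbert hτ) * a) := rfl
    rw [e', vectorTrace_star_mul_self]
    exact ⟨by rw [Complex.ofReal_re]; positivity, Complex.ofReal_im _⟩
  · exact IsLeftMul.one.vectorTrace_eq.trans hτ.map_one
  · exact vectorTrace_mul_comm a.2 b.2
  · exact Subtype.ext (hXp g h).isIdempotentElem.eq
  · exact Subtype.ext (hXp g h).isSelfAdjoint.star_eq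
  · refine Subtype.ext ?_
    have := (IsLeftMul.sum (s := Finset.univ) (hX g)).unique (by rw [hsum]; exact .one)
    simpa using this
  · refine Subtype.ext ?_
    exact ((hX g h).mul (hX g' h')).unique (by rw [horth g g' h h' hg hh]; exact .zero)

end GNS

/-! ### The trace representation on a finite-dimensional Hilbert space -/

/-- The von Neumann algebra of all bounded operators on `H`. -/
def allOperators (H : Type v) [NormedAddCommGroup H] [InnerProductSpace ℂ H] [CompleteSpace H] :
    VonNeumannAlgebra H where
  toStarSubalgebra := ⊤
  centralizer_centralizer' := Set.eq_univ_of_univ_subset Set.subset_centralizer_centralizer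

/-- The rank one projections of an orthonormal basis indexed by the vertices represent every
graph, with the normalized trace. -/
theorem hasTracialSubspaceRep_card {V : Type w} [Fintype V] [Nonempty V] (G : SimpleGraph V) :
    HasTracialSubspaceRep.{v} G (Fintype.card V) := by
  classical
  let H : Type v := EuclideanSpace ℂ (ULift.{v} (Fin (Fintype.card V)))
  let b : OrthonormalBasis V ℂ H := (EuclideanSpace.basisFun _ ℂ).reindex
    (Equiv.ulift.trans (Fintype.equivFin V).symm)
  let n : ℂ := Fintype.card V
  have hn : n ≠ 0 := Nat.cast_ne_zero.2 Fintype.card_ne_zero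
  let τ : (allOperators H).toStarSubalgebra →ₗ[ℂ] ℂ := n⁻¹ • (LinearMap.trace ℂ H) ∘ₗ
    (ContinuousLinearMap.coeLM ℂ) ∘ₗ (allOperators H).toStarSubalgebra.subtype.toAlgHom.toLinearMap
  have hτ (X : (allOperators H).toStarSubalgebra) :
      τ X = n⁻¹ * ∑ g, inner ℂ (b g) ((X : H →L[ℂ] H) (b g)) := by
    change n⁻¹ * LinearMap.trace ℂ H (X : H →L[ℂ] H).toLinearMap = _
    rw [LinearMap.trace_eq_sum_inner _ b]
    rfl
  let K (g : V) : Submodule ℂ H := ℂ ∙ b g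
  let E (g : V) : (allOperators H).toStarSubalgebra := ⟨(K g).starProjection, trivial⟩
  have hE (g g' : V) : (K g).starProjection (b g') = if g = g' then b g' else 0 := by
    split_ifs with h
    · exact Submodule.starProjection_eq_self_iff.2 (h ▸ Submodule.mem_span_singleton_self _)
    · rw [Submodule.starProjection_apply_eq_zero_iff,
        Submodule.mem_orthogonal_singleton_iff_inner_right]
      exact b.orthonormal.2 h
  refine ⟨H, _, _, _, allOperators H, τ, E, ⟨fun X => ?_, ?_, fun X Y => ?_⟩, ?_, fun g => ⟨?_, ?_⟩,
    fun g => ?_, fun g => ?_⟩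
  · have h1 : τ (star X * X) =
        (((Fintype.card V : ℝ)⁻¹ * ∑ g, ‖(X : H →L[ℂ] H) (b g)‖ ^ 2 : ℝ) : ℂ) := by
      rw [hτ]
      push_cast
      congr 1
      refine Finset.sum_congr rfl fun g _ => ?_
      exact (ContinuousLinearMap.adjoint_inner_right (X : H →L[ℂ] H) _ _).trans
        (inner_self_eq_norm_sq_to_K (𝕜 := ℂ) ((X : H →L[ℂ] H) (b g)))
    rw [h1]
    exact ⟨by rw [Complex.ofReal_re]; positivity, Complex.ofReal_im _⟩
  · rw [hτ]
    have (g : V) : inner ℂ (b g) (((1 : (allOperators H).toStarSubalgebra) : H →L[ℂ] H) (b g)) =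
        (1 : ℂ) := (inner_self_eq_norm_sq_to_K (b g)).trans (by simp)
    simp only [this, Finset.sum_const, Finset.card_univ, nsmul_eq_mul, mul_one]
    exact inv_mul_cancel₀ hn
  · exact congrArg (n⁻¹ * ·) (LinearMap.trace_mul_comm ℂ (X : H →L[ℂ] H).toLinearMap
      (Y : H →L[ℂ] H).toLinearMap)
  · intro ι _ _ _ X Y _ _ hX
    simp only [hτ]
    exact (tendsto_finsetSum _ fun g _ => tendsto_const_nhds.inner (hX (b g))).const_mul _
  · exact Subtype.ext isStarProjection_starProjection.isIdempotentElem.eq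
  · exact Subtype.ext isStarProjection_starProjection.isSelfAdjoint.star_eq
  · -- The join of the other projections lies in the orthogonal complement of `b g`.
    have h1 : ((E g : H →L[ℂ] H)).range = K g := Submodule.range_starProjection _
    have h2 : (projJoin (Gᶜ.neighborSet g) (fun g' => (E g' : H →L[ℂ] H))).range ≤ (K g)ᗮ := by
      rw [projJoin, Submodule.range_starProjection]
      refine Submodule.topologicalClosure_minimal _ (iSup₂_le fun g' hg' => ?_)
        (Submodule.isClosed_orthogonal _)
      have h3 : ((E g' : H →L[ℂ] H)).range = K g' := Submodule.range_starProjection _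
      rw [h3, Submodule.span_singleton_le_iff_mem,
        Submodule.mem_orthogonal_singleton_iff_inner_right]
      exact b.orthonormal.2 (show Gᶜ.Adj g g' from hg').ne
    have h4 : (E g : H →L[ℂ] H).range ⊓
        (projJoin (Gᶜ.neighborSet g) (fun g' => (E g' : H →L[ℂ] H))).range = ⊥ := by
      rw [eq_bot_iff, h1, ← Submodule.inf_orthogonal_eq_bot (K g)]
      exact inf_le_inf_left _ h2
    have h5 (U : Submodule ℂ H) (hU : U = ⊥) : U.topologicalClosure.starProjection = 0 := by
      subst hU
      ext1 x
      rw [zero_apply, Submodule.starProjection_apply_eq_zero_iff,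
        (isClosed_singleton (x := (0 : H))).submodule_topologicalClosure_eq]
      simp
    exact h5 _ h4
  · rw [hτ]
    have (g' : V) : inner ℂ (b g') ((E g : H →L[ℂ] H) (b g')) = if g = g' then (1 : ℂ) else 0 := by
      change inner ℂ (b g') ((K g).starProjection (b g')) = _
      rw [hE]
      split_ifs
      · exact (inner_self_eq_norm_sq_to_K (b g')).trans (by simp)
      · exact inner_zero_right _
    simp only [this, Finset.sum_ite_eq, Finset.mem_univ, if_true, mul_one]
    simp [n]

/-! ### The commuting quantum independence number of strong powers -/

section Capacity

variable {V : Type w} [Fintype V]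

theorem le_of_mem_qcIndepSet {G : SimpleGraph V} {lam : ℝ} (hlam : 0 < lam)
    (h : HasTracialSubspaceRep.{v} G lam) (k : ℕ) {d : ℕ}
    (hd : d ∈ qcIndepSet.{u} (strongPow G k)) : (d : ℝ) ≤ lam ^ k :=
  (h.hasAlgRep.strongPow k).le_of_qcHom (pow_pos hlam k) hd

theorem le_card_of_mem_qcIndepSet {G : SimpleGraph V} {d : ℕ} (hd : d ∈ qcIndepSet.{u} G) :
    d ≤ Fintype.card V := by
  rcases isEmpty_or_nonempty V with hV | hV
  · obtain ⟨A, _, τ, E, hτ, -, hsum, -⟩ := hd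
    by_contra! h
    have h1 := hτ.map_one
    rw [← hsum ⟨0, pos_of_gt h⟩, Finset.univ_eq_empty, Finset.sum_empty, map_zero] at h1
    exact zero_ne_one h1
  · exact_mod_cast (hasTracialSubspaceRep_card.{0} G).hasAlgRep.le_of_qcHom
      (Nat.cast_pos.2 Fintype.card_pos) hd

theorem bddAbove_qcIndepSet (G : SimpleGraph V) : BddAbove (qcIndepSet.{u} G) :=
  ⟨Fintype.card V, fun _ hd => le_card_of_mem_qcIndepSet hd⟩

/-- A classical family of vertices indexed by at most one element gives a quantum homomorphism,
with scalar projections. -/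
theorem mem_qcIndepSet_of_subsingleton (G : SimpleGraph V) {d : ℕ} [Subsingleton (Fin d)]
    (f : Fin d → V) : d ∈ qcIndepSet.{u} G := by
  classical
  -- `PUnit → ℂ` is a copy of `ℂ` in the required universe.
  refine ⟨PUnit.{u + 1} → ℂ, inferInstance, LinearMap.proj PUnit.unit,
    fun i g => if g = f i then 1 else 0, ⟨fun a => ?_, rfl, fun a b => mul_comm _ _⟩, fun i g => ?_,
    fun i => by simp, fun i j g h hij => (hij.ne (Subsingleton.elim i j)).elim⟩
  · have : (LinearMap.proj PUnit.unit : (PUnit.{u + 1} → ℂ) →ₗ[ℂ] ℂ) (star a * a) =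
        ((Complex.normSq (a PUnit.unit) : ℝ) : ℂ) := Complex.normSq_eq_conj_mul_self.symm
    rw [this]
    exact ⟨by rw [Complex.ofReal_re]; exact Complex.normSq_nonneg _, Complex.ofReal_im _⟩
  · dsimp only
    split_ifs
    · exact .one _
    · exact .zero _

theorem isGreatest_alphaQC (G : SimpleGraph V) : IsGreatest (qcIndepSet.{u} G) (alphaQC.{u} G) :=
  ⟨Nat.sSup_mem ⟨0, mem_qcIndepSet_of_subsingleton G Fin.elim0⟩ (bddAbove_qcIndepSet G),
    fun _ hd => le_csSup (bddAbove_qcIndepSet G) hd⟩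

theorem one_le_alphaQC [Nonempty V] (G : SimpleGraph V) : 1 ≤ alphaQC.{u} G :=
  (isGreatest_alphaQC G).2 (mem_qcIndepSet_of_subsingleton G fun _ => Classical.arbitrary V)

theorem alphaQC_strongPow_le {G : SimpleGraph V} {lam : ℝ} (hlam : 0 < lam)
    (h : HasTracialSubspaceRep.{v} G lam) (k : ℕ) :
    (alphaQC.{u} (strongPow G k) : ℝ) ≤ lam ^ k :=
  le_of_mem_qcIndepSet hlam h k (isGreatest_alphaQC _).1

omit [Fintype V] in
theorem strongPow_compl_compl_adj_or_eq {G : SimpleGraph V} {k : ℕ} {a b : Fin k → V} :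
    ((strongPow G k)ᶜᶜ.Adj a b ∨ a = b) ↔ ∀ i, a i = b i ∨ G.Adj (a i) (b i) := by
  rw [compl_compl]
  constructor
  · rintro (h | rfl)
    · exact h.2
    · exact fun _ => Or.inl rfl
  · intro h
    exact (eq_or_ne a b).symm.imp_left fun hab => ⟨hab, h⟩

/-- The tensor products of the projections for two strong powers serve for their product. -/
theorem mul_mem_qcIndepSet {G : SimpleGraph V} {k l c d : ℕ}
    (hc : c ∈ qcIndepSet.{u} (strongPow G k)) (hd : d ∈ qcIndepSet.{u} (strongPow G l)) :
    c * d ∈ qcIndepSet.{u} (strongPow G (k + l)) := by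
  obtain ⟨A, _, τ, E, hτ, hE, hEsum, hEorth⟩ := hc
  obtain ⟨B, _, σ, F, hσ, hF, hFsum, hForth⟩ := hd
  refine QCHom.of_tracialAlgebra (A := A ⊗[ℂ] B) (hτ.tensor hσ)
    (E := fun i a => E (finProdFinEquiv.symm i).1 (fun j => a (Fin.castAdd l j)) ⊗ₜ
      F (finProdFinEquiv.symm i).2 (fun j => a (Fin.natAdd k j)))
    (fun i a => (hE _ _).tmul (hF _ _)) (fun i => ?_) (fun i i' a a' hi ha => ?_)
  · rw [← (Fin.appendEquiv k l).sum_comp, Fintype.sum_prod_type]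
    simp only [Fin.appendEquiv, Equiv.coe_fn_mk, Fin.append_left, Fin.append_right]
    simp only [← TensorProduct.tmul_sum, ← TensorProduct.sum_tmul, hFsum, hEsum]
    rfl
  · rw [strongPow_compl_compl_adj_or_eq] at ha
    rw [Algebra.TensorProduct.tmul_mul_tmul]
    by_cases h : (finProdFinEquiv.symm i).1 = (finProdFinEquiv.symm i').1
    · have h' : (finProdFinEquiv.symm i).2 ≠ (finProdFinEquiv.symm i').2 := fun h' =>
        hi.ne (finProdFinEquiv.symm.injective (Prod.ext h h'))
      rw [hForth _ _ _ _ h' (strongPow_compl_compl_adj_or_eq.2 fun j => ha _),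
        TensorProduct.tmul_zero]
    · rw [hEorth _ _ _ _ h (strongPow_compl_compl_adj_or_eq.2 fun j => ha _),
        TensorProduct.zero_tmul]

theorem alphaQC_le_alphaQC_strongPow_one (G : SimpleGraph V) :
    alphaQC.{u} G ≤ alphaQC.{u} (strongPow G 1) := by
  refine (isGreatest_alphaQC _).2 ?_
  obtain ⟨A, _, τ, E, hτ, hE, hsum, horth⟩ := (isGreatest_alphaQC.{u} G).1
  refine ⟨A, _, τ, fun i a => E i (a 0), hτ, fun i a => hE _ _, fun i => ?_,
    fun i j a b hij hab => ?_⟩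
  · rw [← hsum i]
    exact Fintype.sum_equiv (Equiv.funUnique (Fin 1) V) _ _ fun a => rfl
  · refine horth i j _ _ hij ?_
    rw [compl_compl]
    exact (strongPow_compl_compl_adj_or_eq.1 hab 0).symm

/-! ### Existence of the capacity -/

/-- On the graph without vertices the sequence is constantly `0`, except that the power with
exponent `0` has one vertex. -/
theorem thetaQCSeq_of_isEmpty [IsEmpty V] (G : SimpleGraph V) {k : ℕ} (hk : k ≠ 0) :
    thetaQCSeq.{u} G k = 0 := by
  have : Nonempty (Fin k) := ⟨⟨0, Nat.pos_of_ne_zero hk⟩⟩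
  have h0 := le_card_of_mem_qcIndepSet (isGreatest_alphaQC.{u} (strongPow G k)).1
  rw [Fintype.card_eq_zero, Nat.le_zero] at h0
  rw [thetaQCSeq, h0, Nat.cast_zero, Real.zero_rpow (by positivity)]

/-- Fekete's lemma for the supermultiplicative sequence `α_qc (G ^ k)`: its `k`-th roots converge
to their supremum. -/
theorem exists_tendsto_thetaQCSeq (G : SimpleGraph V) :
    ∃ L, Tendsto (thetaQCSeq.{u} G) atTop (𝓝 L) ∧ ∀ k ≠ 0, thetaQCSeq.{u} G k ≤ L := by
  rcases isEmpty_or_nonempty V with hV | hV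
  · exact ⟨0, tendsto_const_nhds.congr' ((eventually_ne_atTop 0).mono fun k hk =>
      (thetaQCSeq_of_isEmpty G hk).symm), fun k hk => (thetaQCSeq_of_isEmpty G hk).le⟩
  · have hpos (k : ℕ) : (0 : ℝ) < alphaQC.{u} (strongPow G k) :=
      Nat.cast_pos.2 (one_le_alphaQC (strongPow G k))
    have hsub : Subadditive fun k => -Real.log (alphaQC.{u} (strongPow G k)) := by
      intro k l
      rw [← neg_add, neg_le_neg_iff, ← Real.log_mul (hpos k).ne' (hpos l).ne']
      refine Real.log_le_log (mul_pos (hpos k) (hpos l)) ?_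
      exact_mod_cast (isGreatest_alphaQC _).2
        (mul_mem_qcIndepSet (isGreatest_alphaQC _).1 (isGreatest_alphaQC _).1)
    have hbdd : BddBelow (Set.range fun k : ℕ =>
        -Real.log (alphaQC.{u} (strongPow G k)) / k) := by
      refine ⟨-Real.log (Fintype.card V), ?_⟩
      rintro _ ⟨k, rfl⟩
      have hcard : (1 : ℝ) ≤ Fintype.card V := Nat.one_le_cast.2 Fintype.card_pos
      dsimp only
      rcases Nat.eq_zero_or_pos k with rfl | hk
      · simpa using Real.log_nonneg hcard
      · rw [le_div_iff₀ (Nat.cast_pos.2 hk), neg_mul, neg_le_neg_iff, mul_comm, ← Real.log_pow]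
        exact Real.log_le_log (hpos k) (alphaQC_strongPow_le (by positivity)
          (hasTracialSubspaceRep_card.{0} G) k)
    have hseq (k : ℕ) : thetaQCSeq.{u} G k =
        Real.exp (-(-Real.log (alphaQC.{u} (strongPow G k)) / k)) := by
      rw [thetaQCSeq, Real.rpow_def_of_pos (hpos k)]
      congr 1; ring
    refine ⟨Real.exp (-hsub.lim), ?_, fun k hk => ?_⟩
    · exact ((Real.continuous_exp.tendsto _).comp (hsub.tendsto_lim hbdd).neg).congr
        fun k => (hseq k).symm
    · rw [hseq]
      exact Real.exp_le_exp.2 (neg_le_neg (hsub.lim_le_div hbdd hk))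

theorem thetaQCSeq_le_tracialHaemers (G : SimpleGraph V) {k : ℕ} (hk : k ≠ 0) :
    thetaQCSeq.{u} G k ≤ tracialHaemers.{v} G := by
  rcases isEmpty_or_nonempty V with hV | hV
  · rw [thetaQCSeq_of_isEmpty G hk]
    exact Real.sInf_nonneg fun lam hlam => hlam.1.le
  · refine le_csInf ⟨_, Nat.cast_pos.2 Fintype.card_pos, hasTracialSubspaceRep_card G⟩ ?_
    rintro lam ⟨hlam, h⟩
    rw [thetaQCSeq, one_div,
      Real.rpow_inv_le_iff_of_pos (Nat.cast_nonneg _) hlam.le (by positivity), Real.rpow_natCast]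
    exact alphaQC_strongPow_le hlam h k

end Capacity

end

theorem mainTheorem2 {V : Type w} [Fintype V] (G : SimpleGraph V) :
    -- `α_qc(G)` is a maximum and the limit defining `Θ_qc(G)` exists
    IsGreatest (qcIndepSet.{u} G) (alphaQC.{u} G) ∧
    Tendsto (thetaQCSeq.{u} G) atTop (𝓝 (thetaQC.{u} G)) ∧
    -- the bound on the independence number
    (alphaQC.{u} G : ℝ) ≤ tracialHaemers.{v} G ∧
    -- the chain through the capacity
    (alphaQC.{u} G : ℝ) ≤ thetaQC.{u} G ∧
    thetaQC.{u} G ≤ tracialHaemers.{v} G := by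
  obtain ⟨L, hL, hle⟩ := exists_tendsto_thetaQCSeq.{u} G
  have hθ : thetaQC.{u} G = L := hL.limUnder_eq
  have h1 : (alphaQC.{u} G : ℝ) ≤ L := by
    refine le_trans ?_ (hle 1 one_ne_zero)
    rw [thetaQCSeq, Nat.cast_one, div_one, Real.rpow_one]
    exact_mod_cast alphaQC_le_alphaQC_strongPow_one G
  have h2 : L ≤ tracialHaemers.{v} G :=
    le_of_tendsto hL ((eventually_ne_atTop 0).mono fun k hk => thetaQCSeq_le_tracialHaemers G hk)
  rw [hθ]
  exact ⟨isGreatest_alphaQC G, hL, h1.trans h2, h1, h2⟩
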